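/- A $C^*$-seminorm on a complex $*$-algebra is a submultiplicative seminorm $p$ with $p(a^*a)=p(a)^2$. A locally $C^*$-algebra is a complete Hausdorff complex topological $*$-algebra $A$ such that a net $(a_i)$ converges to $0$ if and only if $p(a_i)\to 0$ for every $p$ in the set $S(A)$ of all continuous $C^*$-seminorms on $A$. A Hilbert $A$-module is a complex vector space $E$ with a compatible right $A$-action and a definite positive hermitian $A$-valued inner product, $\mathbb{C}$- and $A$-linear in the second variable, that is complete for the seminorms $\overline p_E(\xi)=\sqrt{p(\langle\xi,\xi\rangle)}$, $p\in S(A)$. $L_A(E,F)$ is the space of all adjointable $A$-module morphisms $T:E\to F$, with the topology of the seminorms $\widetilde p_{L_A(E,F)}(T)=\sup\{\overline p_F(T\xi):\overline p_E(\xi)\le 1\}$, $p\in S(A)$; $L_A(E)=L_A(E,E)$ is a $*$-algebra under composition and $T\mapsto T^*$. $M(A)$ is the algebra of multipliers $(l,r)$ of $A$ (pairs of linear maps $A\to A$ with $l(ab)=l(a)b$, $r(ab)=ar(b)$, $al(b)=r(a)b$), with the topology of the seminorms $p_{M(A)}(l,r)=\sup\{p(l(a)):p(a)\le 1\}$, $p\in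 S(A)$; it is identified with $L_A(A)$. The multiplier module $M(E)=L_A(A,E)$ is the $M(A)$-module with $t\cdot m=t\circ m$ and $\langle s,t\rangle=s^*\circ t$, and $E$ is regarded as a submodule of $M(E)$ through $i_E(\xi)(a)=\xi a$. The spaces $L_{M(A)}(M(E),M(F))$ are defined as above, with $M(A)$ in place of $A$, and $\widetilde p_{L_{M(A)}(M(E),M(F))}$ denotes the seminorm associated with $p_{M(A)}$. Theorem 4.1. Let $A$ be a locally $C^*$-algebra and let $E$ and $F$ be Hilbert $A$-modules. (1) $L_{M(A)}(M(E),M(F))$ and $L_A(E,F)$ are complete Hausdorff locally convex spaces. Every $T\in L_{M(A)}(M(E),M(F))$ maps $E$ into $F$, and $T\mapsto T|_E$ is an isomorphism of locally convex spaces (a linear homeomorphism) from $L_{M(A)}(M(E),M(F))$ onto $L_A(E,F)$, with $\widetilde p_{L_A(E,F)}(T|_E)=\widetilde p_{L_{M(A)}(M(E),M(F))}(T)$ for all $p\in S(A)$ and all $T$. (2) $L_{M(A)}(M(E))$ and $L_A(E)$ are locally $C^*$-algebras, and $T\mapsto T|_E$ is an isomorphism of locally $C^*$-algebras (a bijective $*$-homomorphism,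 continuous in both directions) from $L_{M(A)}(M(E))$ onto $L_A(E)$, with $\widetilde p_{L_A(E)}(T|_E)=\widetilde p_{L_{M(A)}(M(E))}(T)$ for all $p\in S(A)$ and all $T$. -/

import Mathlib

open Filter Topology

noncomputable section

namespace LocallyCStar

/-- A `C*`-seminorm on a complex `*`-algebra: a submultiplicative seminorm `p` with
`p (a* a) = p a ^ 2`. -/
structure IsCStarSeminorm {A : Type*} [NonUnitalRing A] [StarRing A] [Module ℂ A]
    (p : A → ℝ) : Prop where
  add_le : ∀ a b, p (a + b) ≤ p a + p b
  smul_eq : ∀ (c : ℂ) a, p (c • a) = ‖c‖ * p a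
  mul_le : ∀ a b, p (a * b) ≤ p a * p b
  star_mul_self : ∀ a, p (star a * a) = p a ^ 2

/-- The set `S(A)` of all continuous `C*`-seminorms on `A`. -/
def contSeminorms (A : Type*) [NonUnitalRing A] [StarRing A] [Module ℂ A]
    [TopologicalSpace A] : Set (A → ℝ) :=
  {p | IsCStarSeminorm p ∧ Continuous p}

/-- The topology determined by a family `P` of seminorms on `X`: the coarsest one for which all
the functions `x ↦ q (x - x₀)`, with `q` in `P` and `x₀` in `X`, are continuous. -/
abbrev seminormTopology {X : Type*} [Sub X] (P : Set (X → ℝ)) : TopologicalSpace X :=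
  ⨅ q ∈ P, ⨅ x₀ : X, TopologicalSpace.induced (fun x => q (x - x₀)) inferInstance

/-- A locally `C*`-algebra: a complete Hausdorff complex topological `*`-algebra in which a net
converges to `0` if and only if its image under every continuous `C*`-seminorm does. -/
class LocallyCStarAlgebra (A : Type*) [NonUnitalRing A] [StarRing A] [Module ℂ A]
    [IsScalarTower ℂ A A] [SMulCommClass ℂ A A] [StarModule ℂ A] [TopologicalSpace A] : Prop
    extends IsTopologicalRing A, ContinuousSMul ℂ A, ContinuousStar A, T2Space A where
  le_nhds_zero_iff : ∀ l : Filter A,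
    l ≤ 𝓝 0 ↔ ∀ p ∈ contSeminorms A, Tendsto p l (𝓝 0)
  complete : @CompleteSpace A (IsTopologicalAddGroup.rightUniformSpace A)

/-- A complete Hausdorff locally convex complex vector space. -/
class CompleteLocallyConvex (X : Type*) [AddCommGroup X] [Module ℂ X] [TopologicalSpace X] : Prop
    extends IsTopologicalAddGroup X, ContinuousSMul ℂ X, T2Space X, LocallyConvexSpace ℝ X where
  complete : @CompleteSpace X (IsTopologicalAddGroup.rightUniformSpace X)

/-- The algebraic part of the structure of a pre-Hilbert module: a complex vector space with a
right action `act` of `A` and a definite hermitian `A`-valued inner product `inn`, linear in its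
second variable. Positivity of the inner product is required in `HilbertModule`. -/
class InnerModule (A E : Type*) [NonUnitalRing A] [StarRing A] [Module ℂ A]
    [AddCommGroup E] [Module ℂ E] where
  act : E → A → E
  inn : E → E → A
  add_act : ∀ ξ η a, act (ξ + η) a = act ξ a + act η a
  act_add : ∀ ξ a b, act ξ (a + b) = act ξ a + act ξ b
  act_mul : ∀ ξ a b, act ξ (a * b) = act (act ξ a) b
  smul_act : ∀ (c : ℂ) ξ a, act (c • ξ) a = c • act ξ a
  act_smul : ∀ (c : ℂ) ξ a, act ξ (c • a) = c • act ξ a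
  inn_add : ∀ ξ η ζ, inn ξ (η + ζ) = inn ξ η + inn ξ ζ
  inn_smul : ∀ ξ (c : ℂ) η, inn ξ (c • η) = c • inn ξ η
  inn_act : ∀ ξ η a, inn ξ (act η a) = inn ξ η * a
  star_inn : ∀ ξ η, star (inn ξ η) = inn η ξ
  inn_self_eq_zero : ∀ ξ, inn ξ ξ = 0 ↔ ξ = 0

/-- The seminorm `ξ ↦ √(p ⟨ξ, ξ⟩)` on `E` associated with a seminorm `p` on `A`. -/
def vecSeminorm {A E : Type*} [NonUnitalRing A] [StarRing A] [Module ℂ A]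
    [AddCommGroup E] [Module ℂ E] [InnerModule A E] (p : A → ℝ) (ξ : E) : ℝ :=
  √(p (InnerModule.inn ξ ξ))

/-- A Hilbert `A`-module: the inner product is positive (the positive elements of a locally
`C*`-algebra are those of the form `b* b`) and `E` is complete for the family of seminorms
`ξ ↦ √(p ⟨ξ, ξ⟩)`, `p ∈ S(A)`: every Cauchy filter converges. -/
class HilbertModule (A E : Type*) [NonUnitalRing A] [StarRing A] [Module ℂ A]
    [TopologicalSpace A] [AddCommGroup E] [Module ℂ E] [InnerModule A E] : Prop where
  inn_self_nonneg : ∀ ξ : E, ∃ b : A, InnerModule.inn ξ ξ = star b * b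
  complete : ∀ f : Filter E, f.NeBot →
    (∀ p ∈ contSeminorms A, ∀ ε > 0, ∃ s ∈ f, ∀ ξ ∈ s, ∀ η ∈ s, vecSeminorm p (ξ - η) < ε) →
    ∃ ξ : E, ∀ p ∈ contSeminorms A, Tendsto (fun η => vecSeminorm p (η - ξ)) f (𝓝 0)

section InnerModule

variable {A E : Type*} [NonUnitalRing A] [StarRing A] [Module ℂ A]
  [AddCommGroup E] [Module ℂ E] [InnerModule A E]

theorem add_inn (ξ η ζ : E) :
    (InnerModule.inn (ξ + η) ζ : A) = InnerModule.inn ξ ζ + InnerModule.inn η ζ := by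
  rw [← InnerModule.star_inn, InnerModule.inn_add, star_add, InnerModule.star_inn,
    InnerModule.star_inn]

theorem smul_inn [StarModule ℂ A] (c : ℂ) (ξ ζ : E) :
    (InnerModule.inn (c • ξ) ζ : A) = star c • InnerModule.inn ξ ζ := by
  rw [← InnerModule.star_inn, InnerModule.inn_smul, star_smul, InnerModule.star_inn]

theorem act_inn (ξ : E) (a : A) (ζ : E) :
    (InnerModule.inn (InnerModule.act ξ a) ζ : A) = star a * InnerModule.inn ξ ζ := by
  rw [← InnerModule.star_inn, InnerModule.inn_act, star_mul, InnerModule.star_inn]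

theorem inn_zero (ξ : E) : (InnerModule.inn ξ (0 : E) : A) = 0 := by
  have := InnerModule.inn_add (A := A) ξ 0 0
  simpa using this

theorem inn_sub (ξ η ζ : E) :
    (InnerModule.inn ξ (η - ζ) : A) = InnerModule.inn ξ η - InnerModule.inn ξ ζ := by
  have := InnerModule.inn_add (A := A) ξ (η - ζ) ζ
  rw [sub_add_cancel] at this
  rw [this, add_sub_cancel_right]

theorem ext_inn (A : Type*) [NonUnitalRing A] [StarRing A] [Module ℂ A] [InnerModule A E]
    {η ζ : E} (h : ∀ ξ : E, (InnerModule.inn ξ η : A) = InnerModule.inn ξ ζ) : η = ζ := by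
  rw [← sub_eq_zero, ← InnerModule.inn_self_eq_zero (A := A), inn_sub, h, sub_self]

end InnerModule

/-! ### Adjointable operators -/

section Adjointable

variable (A E F : Type*) [NonUnitalRing A] [StarRing A] [Module ℂ A] [StarModule ℂ A]
  [AddCommGroup E] [Module ℂ E] [InnerModule A E]
  [AddCommGroup F] [Module ℂ F] [InnerModule A F]

/-- The linear maps `E → F` that are `A`-module morphisms. -/
def IsModuleMorphism {E F : Type*} [AddCommGroup E] [Module ℂ E] [InnerModule A E]
    [AddCommGroup F] [Module ℂ F] [InnerModule A F] (T : E →ₗ[ℂ] F) : Prop :=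
  ∀ (ξ : E) (a : A), T (InnerModule.act ξ a) = InnerModule.act (T ξ) a

/-- `S` is an adjoint of `T`. -/
def IsAdjoint {E F : Type*} [AddCommGroup E] [Module ℂ E] [InnerModule A E]
    [AddCommGroup F] [Module ℂ F] [InnerModule A F] (T : E →ₗ[ℂ] F) (S : F →ₗ[ℂ] E) : Prop :=
  ∀ ξ η, (InnerModule.inn (T ξ) η : A) = InnerModule.inn ξ (S η)

/-- The space of adjointable `A`-module morphisms as a subspace of the linear maps. -/
def adjointableSubmodule : Submodule ℂ (E →ₗ[ℂ] F) where
  carrier := {T | IsModuleMorphism A T ∧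
    ∃ S : F →ₗ[ℂ] E, IsModuleMorphism A S ∧ IsAdjoint A T S}
  zero_mem' := by
    have hE : ∀ a : A, InnerModule.act (0 : E) a = 0 := fun a => by
      simpa using InnerModule.add_act (0 : E) 0 a
    have hF : ∀ a : A, InnerModule.act (0 : F) a = 0 := fun a => by
      simpa using InnerModule.add_act (0 : F) 0 a
    refine ⟨fun ξ a => by simp [hF], 0, fun ξ a => by simp [hE], fun ξ η => ?_⟩
    simp only [LinearMap.zero_apply]
    rw [← InnerModule.star_inn, inn_zero, inn_zero, star_zero]
  add_mem' := by
    rintro T₁ T₂ ⟨h₁, S₁, k₁, a₁⟩ ⟨h₂, S₂, k₂, a₂⟩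
    refine ⟨fun ξ a => ?_, S₁ + S₂, fun ξ a => ?_, fun ξ η => ?_⟩
    · simp only [LinearMap.add_apply, h₁ ξ a, h₂ ξ a, InnerModule.add_act]
    · simp only [LinearMap.add_apply, k₁ ξ a, k₂ ξ a, InnerModule.add_act]
    · simp only [LinearMap.add_apply, add_inn, InnerModule.inn_add, a₁ ξ η, a₂ ξ η]
  smul_mem' := by
    rintro c T ⟨h, S, k, ad⟩
    refine ⟨fun ξ a => ?_, star c • S, fun ξ a => ?_, fun ξ η => ?_⟩
    · simp only [LinearMap.smul_apply, h ξ a, InnerModule.smul_act]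
    · simp only [LinearMap.smul_apply, k ξ a, InnerModule.smul_act]
    · simp only [LinearMap.smul_apply, smul_inn, InnerModule.inn_smul, ad ξ η]

/-- The space `L_A(E, F)` of adjointable `A`-module morphisms from `E` to `F`. -/
def Adjointable : Type _ := adjointableSubmodule A E F

instance : AddCommGroup (Adjointable A E F) :=
  inferInstanceAs (AddCommGroup (adjointableSubmodule A E F))

instance : Module ℂ (Adjointable A E F) :=
  inferInstanceAs (Module ℂ (adjointableSubmodule A E F))

instance : FunLike (Adjointable A E F) E F where
  coe T := T.1
  coe_injective _ _ h := Subtype.ext (DFunLike.coe_injective h)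

variable {A E F}

namespace Adjointable

@[ext] theorem ext {T S : Adjointable A E F} (h : ∀ ξ, T ξ = S ξ) : T = S := DFunLike.ext _ _ h

theorem add_apply (T S : Adjointable A E F) (ξ : E) : (T + S) ξ = T ξ + S ξ := rfl
theorem zero_apply (ξ : E) : (0 : Adjointable A E F) ξ = 0 := rfl
theorem smul_apply (c : ℂ) (T : Adjointable A E F) (ξ : E) : (c • T) ξ = c • T ξ := rfl
theorem map_add (T : Adjointable A E F) (ξ η : E) : T (ξ + η) = T ξ + T η := T.1.map_add ξ η
theorem map_smul (T : Adjointable A E F) (c : ℂ) (ξ : E) : T (c • ξ) = c • T ξ :=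
  T.1.map_smul c ξ
theorem map_zero (T : Adjointable A E F) : T (0 : E) = 0 := T.1.map_zero
theorem map_act (T : Adjointable A E F) (ξ : E) (a : A) :
    T (InnerModule.act ξ a) = InnerModule.act (T ξ) a := T.2.1 ξ a

/-- The adjoint `T*` of `T`; it is unique because inner products are definite. -/
def adj (T : Adjointable A E F) : Adjointable A F E :=
  ⟨T.2.2.choose, T.2.2.choose_spec.1, T.1, T.2.1, fun η ξ => by
    rw [← InnerModule.star_inn, ← T.2.2.choose_spec.2 ξ η, InnerModule.star_inn]⟩

theorem inn_adj (T : Adjointable A E F) (ξ : E) (η : F) :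
    (InnerModule.inn (T ξ) η : A) = InnerModule.inn ξ (T.adj η) := T.2.2.choose_spec.2 ξ η

theorem adj_inn (T : Adjointable A E F) (η : F) (ξ : E) :
    (InnerModule.inn (T.adj η) ξ : A) = InnerModule.inn η (T ξ) := by
  rw [← InnerModule.star_inn, ← inn_adj, InnerModule.star_inn]

theorem adj_eq {T : Adjointable A E F} {S : Adjointable A F E}
    (h : ∀ ξ η, (InnerModule.inn (T ξ) η : A) = InnerModule.inn ξ (S η)) : T.adj = S :=
  ext fun η => ext_inn A fun ξ => by rw [← inn_adj, h]

theorem adj_adj (T : Adjointable A E F) : T.adj.adj = T :=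
  adj_eq fun η ξ => adj_inn T η ξ

/-- Composition of adjointable operators. -/
def comp {G : Type*} [AddCommGroup G] [Module ℂ G] [InnerModule A G]
    (T : Adjointable A F G) (S : Adjointable A E F) : Adjointable A E G :=
  ⟨T.1.comp S.1, fun ξ a => by
      change T (S _) = InnerModule.act (T (S ξ)) a
      rw [map_act, map_act], S.adj.1.comp T.adj.1, fun ξ a => by
      change S.adj (T.adj _) = InnerModule.act (S.adj (T.adj ξ)) a
      rw [map_act, map_act], fun ξ η => by
      change (InnerModule.inn (T (S ξ)) η : A) = InnerModule.inn ξ (S.adj (T.adj η))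
      rw [inn_adj, inn_adj]⟩

theorem comp_apply {G : Type*} [AddCommGroup G] [Module ℂ G] [InnerModule A G]
    (T : Adjointable A F G) (S : Adjointable A E F) (ξ : E) : T.comp S ξ = T (S ξ) := rfl

theorem adj_comp {G : Type*} [AddCommGroup G] [Module ℂ G] [InnerModule A G]
    (T : Adjointable A F G) (S : Adjointable A E F) : (T.comp S).adj = S.adj.comp T.adj :=
  adj_eq fun ξ η => by rw [comp_apply, comp_apply, inn_adj, inn_adj]

/-- The identity operator. -/
def one : Adjointable A E E :=
  ⟨LinearMap.id, fun _ _ => rfl, LinearMap.id, fun _ _ => rfl, fun _ _ => rfl⟩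

instance : Mul (Adjointable A E E) := ⟨comp⟩
instance : One (Adjointable A E E) := ⟨one⟩

theorem mul_apply (T S : Adjointable A E E) (ξ : E) : (T * S) ξ = T (S ξ) := rfl
theorem one_apply (ξ : E) : (1 : Adjointable A E E) ξ = ξ := rfl

/-- `L_A(E) = L_A(E, E)` is a ring under composition. -/
instance : Ring (Adjointable A E E) :=
  { (inferInstance : AddCommGroup (Adjointable A E E)) with
    mul := (· * ·)
    one := 1
    left_distrib := fun T S R => ext fun ξ => by
      simp only [mul_apply, add_apply, map_add]
    right_distrib := fun T S R => ext fun ξ => rfl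
    zero_mul := fun T => ext fun ξ => rfl
    mul_zero := fun T => ext fun ξ => by simp only [mul_apply, zero_apply, map_zero]
    mul_assoc := fun T S R => ext fun ξ => rfl
    one_mul := fun T => ext fun ξ => rfl
    mul_one := fun T => ext fun ξ => rfl }

instance : Algebra ℂ (Adjointable A E E) :=
  Algebra.ofModule (fun c T S => ext fun ξ => rfl)
    (fun c T S => ext fun ξ => by simp only [mul_apply, smul_apply, map_smul])

/-- `L_A(E)` is a `*`-algebra with `T ↦ T*`. -/
instance : StarRing (Adjointable A E E) where
  star := adj
  star_involutive := adj_adj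
  star_mul T S := adj_comp T S
  star_add T S := adj_eq fun ξ η => by
    change _ = InnerModule.inn ξ (T.adj η + S.adj η)
    rw [add_apply, add_inn, inn_adj, inn_adj, InnerModule.inn_add]

instance : StarModule ℂ (Adjointable A E E) where
  star_smul c T := adj_eq fun ξ η => by
    change _ = InnerModule.inn ξ (star c • T.adj η)
    rw [smul_apply, smul_inn, inn_adj, InnerModule.inn_smul]

/-- The seminorm of `T ∈ L_A(E, F)` associated with a `C*`-seminorm `p` on `A`: the norm of the
operator which `T` induces from `E / ker` to `F / ker`, where both quotients carry the norms
induced by `ξ ↦ √(p ⟨ξ, ξ⟩)`. -/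
def opSeminorm (p : A → ℝ) (T : Adjointable A E F) : ℝ :=
  sSup ((fun ξ : E => vecSeminorm p (T ξ)) '' {ξ : E | vecSeminorm p ξ ≤ 1})

/-- `L_A(E, F)` carries the topology of the seminorms `opSeminorm p`, `p ∈ S(A)`. -/
instance [TopologicalSpace A] : TopologicalSpace (Adjointable A E F) :=
  seminormTopology (opSeminorm '' contSeminorms A)

end Adjointable

end Adjointable

/-! ### The multiplier algebra -/

section Multiplier

variable (A : Type*) [NonUnitalRing A] [StarRing A] [Module ℂ A]
  [IsScalarTower ℂ A A] [SMulCommClass ℂ A A] [StarModule ℂ A]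

/-- The pairs `(l, r)` of linear maps with `l (a b) = l a b`, `r (a b) = a r b` and
`a l b = r a b`. The product is `(l, r) (l', r') = (l l', r' r)`. -/
def multiplierSubalgebra : Subalgebra ℂ (Module.End ℂ A × (Module.End ℂ A)ᵐᵒᵖ) where
  carrier := {m | (∀ a b, m.1 (a * b) = m.1 a * b) ∧
    (∀ a b, m.2.unop (a * b) = a * m.2.unop b) ∧ ∀ a b, a * m.1 b = m.2.unop a * b}
  mul_mem' := by
    rintro m n ⟨h₁, h₂, h₃⟩ ⟨k₁, k₂, k₃⟩
    refine ⟨fun a b => ?_, fun a b => ?_, fun a b => ?_⟩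
    · simp [h₁, k₁]
    · simp [h₂, k₂]
    · simp [h₃, k₃]
  add_mem' := by
    rintro m n ⟨h₁, h₂, h₃⟩ ⟨k₁, k₂, k₃⟩
    refine ⟨fun a b => ?_, fun a b => ?_, fun a b => ?_⟩
    · simp [h₁, k₁, add_mul]
    · simp [h₂, k₂, mul_add]
    · simp [h₃, k₃, mul_add, add_mul]
  algebraMap_mem' := by
    intro c
    refine ⟨fun a b => ?_, fun a b => ?_, fun a b => ?_⟩ <;>
    simp [Module.algebraMap_end_apply, smul_mul_assoc, mul_smul_comm]

/-- The multiplier algebra `M(A)`. -/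
def Multiplier : Type _ := multiplierSubalgebra A

instance : Ring (Multiplier A) := inferInstanceAs (Ring (multiplierSubalgebra A))

instance : Algebra ℂ (Multiplier A) := inferInstanceAs (Algebra ℂ (multiplierSubalgebra A))

variable {A}

namespace Multiplier

/-- The left part `l` of a multiplier `(l, r)`. -/
def left (m : Multiplier A) : A →ₗ[ℂ] A := m.1.1

/-- The right part `r` of a multiplier `(l, r)`. -/
def right (m : Multiplier A) : A →ₗ[ℂ] A := m.1.2.unop

theorem left_mul (m : Multiplier A) (a b : A) : m.left (a * b) = m.left a * b := m.2.1 a b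
theorem right_mul (m : Multiplier A) (a b : A) : m.right (a * b) = a * m.right b := m.2.2.1 a b
theorem mul_left (m : Multiplier A) (a b : A) : a * m.left b = m.right a * b := m.2.2.2 a b

theorem ext' {m n : Multiplier A} (hl : ∀ a, m.left a = n.left a)
    (hr : ∀ a, m.right a = n.right a) : m = n :=
  Subtype.ext (Prod.ext (LinearMap.ext hl) (MulOpposite.unop_injective (LinearMap.ext hr)))

/-- For a linear map `T`, the linear map `a ↦ (T a*)*`. -/
def conj (T : A →ₗ[ℂ] A) : A →ₗ[ℂ] A where
  toFun a := star (T (star a))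
  map_add' a b := by simp
  map_smul' c a := by simp [star_smul]

theorem conj_apply (T : A →ₗ[ℂ] A) (a : A) : conj T a = star (T (star a)) := rfl

/-- The involution `(l, r)* = (a ↦ (r a*)*, a ↦ (l a*)*)`. -/
instance : StarRing (Multiplier A) where
  star m := ⟨(conj m.right, MulOpposite.op (conj m.left)),
    fun a b => by simp [conj_apply, right_mul],
    fun a b => by simp [conj_apply, left_mul],
    fun a b => by
      have := congrArg star (mul_left m (star b) (star a))
      simpa [conj_apply] using this.symm⟩
  star_involutive m := ext' (fun a => by
      change star (star (m.left (star (star a)))) = _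
      simp) (fun a => by
      change star (star (m.right (star (star a)))) = _
      simp)
  star_mul m n := ext' (fun a => by
      change star (n.right (m.right (star a))) = star (n.right (star (star (m.right (star a)))))
      simp) (fun a => by
      change star (m.left (n.left (star a))) = star (m.left (star (star (n.left (star a)))))
      simp)
  star_add m n := ext' (fun a => star_add (m.right (star a)) (n.right (star a)))
    (fun a => star_add (m.left (star a)) (n.left (star a)))

theorem star_left (m : Multiplier A) (a : A) : (star m).left a = star (m.right (star a)) := rfl
theorem star_right (m : Multiplier A) (a : A) : (star m).right a = star (m.left (star a)) := rfl

instance : StarModule ℂ (Multiplier A) where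
  star_smul c m := ext' (fun a => star_smul c (m.right (star a)))
    (fun a => star_smul c (m.left (star a)))

/-- The seminorm `(l, r) ↦ sup {p (l a) | p a ≤ 1}` on `M(A)`. -/
def seminorm (p : A → ℝ) (m : Multiplier A) : ℝ :=
  sSup ((fun a : A => p (m.left a)) '' {a : A | p a ≤ 1})

/-- `M(A)` carries the topology of the seminorms `seminorm p`, `p ∈ S(A)`. -/
instance [TopologicalSpace A] : TopologicalSpace (Multiplier A) :=
  seminormTopology (seminorm '' contSeminorms A)

end Multiplier

end Multiplier

/-! ### The multiplier module -/

section MultiplierModule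

variable {A : Type*} [NonUnitalRing A] [StarRing A] [Module ℂ A]
  [IsScalarTower ℂ A A] [SMulCommClass ℂ A A] [StarModule ℂ A]
  [TopologicalSpace A] [LocallyCStarAlgebra A]

theorem eq_zero_of_star_mul_self {a : A} (h : star a * a = 0) : a = 0 := by
  have h0 : (pure a : Filter A) ≤ 𝓝 0 := by
    rw [LocallyCStarAlgebra.le_nhds_zero_iff]
    intro p hp
    have h1 : p a ^ 2 = 0 := by
      rw [← hp.1.star_mul_self, h]
      simpa using hp.1.smul_eq 0 0
    have h2 : p a = 0 := by simpa using h1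
    rw [tendsto_pure_left]
    intro s hs
    rw [h2]
    exact mem_of_mem_nhds hs
  have : (pure a : Filter A) ≤ pure 0 := by
    by_contra hne
    have hne' : a ≠ 0 := fun h => hne (by rw [h])
    have hmem : ({a}ᶜ : Set A) ∈ 𝓝 (0 : A) := isOpen_ne.mem_nhds (Ne.symm hne')
    exact (h0 hmem : a ∈ ({a}ᶜ : Set A)) rfl
  simpa using this

/-- `A` as a module over itself, with `⟨a, b⟩ = a* b`. -/
instance : InnerModule A A where
  act a b := a * b
  inn a b := star a * b
  add_act := add_mul
  act_add := mul_add
  act_mul a b c := (mul_assoc a b c).symm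
  smul_act := smul_mul_assoc
  act_smul c a b := mul_smul_comm c a b
  inn_add a b c := mul_add _ b c
  inn_smul a c b := mul_smul_comm c _ b
  inn_act a b c := (mul_assoc _ b c).symm
  star_inn a b := by simp
  inn_self_eq_zero a := ⟨eq_zero_of_star_mul_self, fun h => by simp [h]⟩

/-- A multiplier `(l, r)` as the adjointable operator `l` on `A`. -/
def Multiplier.toAdjointable (m : Multiplier A) : Adjointable A A A :=
  ⟨m.left, m.left_mul, (star m).left, (star m).left_mul, fun a b => by
    change star (m.left a) * b = star a * star (m.right (star b))
    rw [← star_mul, ← m.mul_left, star_mul, star_star]⟩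

/-- An adjointable operator `T` on `A` as the multiplier `(T, a ↦ (T* a*)*)`. -/
def Multiplier.ofAdjointable (T : Adjointable A A A) : Multiplier A :=
  ⟨(T.1, MulOpposite.op (Multiplier.conj T.adj.1)), fun a b => T.map_act a b,
    fun a b => by
      change star (T.adj (star (a * b))) = a * star (T.adj (star b))
      rw [star_mul]
      have := T.adj.map_act (star b) (star a)
      change T.adj (star b * star a) = T.adj (star b) * star a at this
      rw [this, star_mul, star_star],
    fun a b => by
      have := T.adj_inn (star a) b
      change star (T.adj (star a)) * b = star (star a) * T b at this
      rw [star_star] at this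
      exact this.symm⟩

variable (A) (E : Type*) [AddCommGroup E] [Module ℂ E] [InnerModule A E]

/-- The multiplier module `M(E) = L_A(A, E)`. -/
abbrev MultiplierModule : Type _ := Adjointable A A E

variable {A E}

/-- `M(E)` as a module over `M(A)`: `t · m = t ∘ m` and `⟨s, t⟩ = s* ∘ t`, where `M(A)` is
identified with `L_A(A)`. -/
instance : InnerModule (Multiplier A) (MultiplierModule A E) where
  act t m := t.comp m.toAdjointable
  inn s t := Multiplier.ofAdjointable (s.adj.comp t)
  add_act s t m := rfl
  act_add t m n := Adjointable.ext fun a => t.map_add (m.left a) (n.left a)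
  act_mul t m n := rfl
  smul_act c t m := rfl
  act_smul c t m := Adjointable.ext fun a => t.map_smul c (m.left a)
  inn_add s t u := by
    refine Multiplier.ext' (fun a => s.adj.map_add (t a) (u a)) (fun a => ?_)
    change star ((s.adj.comp (t + u)).adj (star a)) =
      star ((s.adj.comp t).adj (star a)) + star ((s.adj.comp u).adj (star a))
    rw [← star_add]
    congr 1
    rw [← Adjointable.add_apply]
    congr 1
    refine Adjointable.adj_eq fun a b => ?_
    rw [Adjointable.add_apply, InnerModule.inn_add, ← Adjointable.inn_adj,
      ← Adjointable.inn_adj, ← add_inn]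
    simp only [Adjointable.comp_apply, Adjointable.add_apply, Adjointable.map_add]
  inn_smul s c t := by
    refine Multiplier.ext' (fun a => s.adj.map_smul c (t a)) (fun a => ?_)
    change star ((s.adj.comp (c • t)).adj (star a)) = c • star ((s.adj.comp t).adj (star a))
    have : (s.adj.comp (c • t)).adj = star c • (s.adj.comp t).adj := by
      refine Adjointable.adj_eq fun a b => ?_
      rw [Adjointable.smul_apply, InnerModule.inn_smul, ← Adjointable.inn_adj, ← smul_inn]
      simp only [Adjointable.comp_apply, Adjointable.smul_apply, Adjointable.map_smul]
    rw [this, Adjointable.smul_apply, star_smul, star_star]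
  inn_act s t m := by
    refine Multiplier.ext' (fun a => rfl) (fun a => ?_)
    change star ((s.adj.comp (t.comp m.toAdjointable)).adj (star a)) =
      m.right (star ((s.adj.comp t).adj (star a)))
    have h1 : m.toAdjointable.adj = (star m).toAdjointable :=
      Adjointable.adj_eq fun a b => by
        change star (m.left a) * b = star a * star (m.right (star b))
        rw [← star_mul, ← m.mul_left, star_mul, star_star]
    rw [Adjointable.adj_comp, Adjointable.adj_comp, Adjointable.adj_comp, h1]
    change star (star (m.right (star _))) = _
    rw [star_star]
    rfl
  star_inn s t := by
    refine Multiplier.ext' (fun a => ?_) (fun a => ?_)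
    · rw [Multiplier.star_left]
      change star (star ((s.adj.comp t).adj (star (star a)))) = t.adj.comp s a
      rw [star_star, star_star, Adjointable.adj_comp, Adjointable.adj_adj]
    · rw [Multiplier.star_right]
      change star (s.adj.comp t (star a)) = star ((t.adj.comp s).adj (star a))
      rw [Adjointable.adj_comp, Adjointable.adj_adj]
  inn_self_eq_zero t := by
    constructor
    · intro h
      refine Adjointable.ext fun a => ?_
      have h1 : t.adj (t a) = 0 := congrArg (fun m : Multiplier A => m.left a) h
      rw [Adjointable.zero_apply, ← InnerModule.inn_self_eq_zero (A := A), Adjointable.inn_adj,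
        h1, inn_zero]
    · rintro rfl
      refine Multiplier.ext' (fun a => Adjointable.map_zero _) (fun a => ?_)
      change star ((Adjointable.comp (Adjointable.adj 0) 0).adj (star a)) = 0
      rw [Adjointable.adj_comp, Adjointable.adj_adj]
      change star ((Adjointable.adj 0) (0 : E)) = 0
      rw [Adjointable.map_zero, star_zero]

/-- The embedding `i_E : E → M(E)`, `i_E ξ a = ξ · a`. -/
def embed (ξ : E) : MultiplierModule A E :=
  ⟨{ toFun := fun a => InnerModule.act ξ a
     map_add' := InnerModule.act_add ξ
     map_smul' := fun c a => InnerModule.act_smul c ξ a },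
    fun a b => InnerModule.act_mul ξ a b,
    { toFun := fun η => InnerModule.inn ξ η
      map_add' := InnerModule.inn_add ξ
      map_smul' := fun c η => InnerModule.inn_smul ξ c η },
    fun η b => InnerModule.inn_act ξ η b,
    fun a η => act_inn ξ a η⟩

end MultiplierModule

end LocallyCStar

end

open LocallyCStar

/-! Restriction and composition are mutually inverse. For `s : A → E` in `M(E)` and `a` in `A` one
has `s · a = i_E (s a)`, so an `M(A)`-linear `T` that maps `E` into `F` satisfies `T s = T|_E ∘ s`
(`apply_eq_restrict_comp`). Conversely, `S` in `L_A(E, F)` extends to `s ↦ S ∘ s`. Equality of the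
seminorms follows since `i_E` is isometric and operator seminorms are submultiplicative. The work
lies in three other places.

Boundedness (`exists_bound`). That an adjointable operator is bounded for every single `p` does not
follow from completeness of `E / ker p`, which is not available. In place of approximate units the
proof uses the quasi-inverse of `⟨ξ, ξ⟩ / ε²`, which exists in `A` by completeness. It splits `ξ`
into a part that is small for all seminorms at once and a part `ξ a` that is small where `ξ` is
(`exists_cutoff`). A gliding hump bounds `T` on uniformly bounded vectors, and iterating the
splitting gives the bound for `p`.

Restriction (`exists_apply_embed_eq`). With cutoffs `a_n`, the vectors `ξ + ξ a_n` tend to `0`, and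
`T (i_E ξ) (a_n)` is a Cauchy sequence in `F` whose limit is, up to sign, the preimage of `T (i_E
ξ)`. Only the adjoint and Cauchy–Schwarz are used, as `T` is not yet known to be bounded.

Topology (`withSeminorms_multiplierSeminormFamily`). The topology of `L(M(E), M(F))` comes from all
continuous `C*`-seminorms `P` of `M(A)`. Each is dominated by some `p_{M(A)}`
(`exists_le_seminorm`), and operator seminorms are monotone in the seminorm (`opSeminorm_mono`). The
latter rests on a moment inequality for `⟨ξ, (T* T)ⁿ ξ⟩`. Completeness and the `C*`-identity are
then transported from `L_A(E, F)`.

Order arguments take place in a unital `C*`-algebra `CStarHull hp` that contains `A / ker p`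
isometrically. -/

set_option linter.unusedSectionVars false

noncomputable section

namespace LocallyCStar

universe u

/-! ### Completions of unital pre-`C*`-algebras -/

section CompletionOfPreCStar

open UniformSpace

variable {X : Type*} [NormedRing X] [StarRing X] [CStarRing X] [NormedAlgebra ℂ X]
  [StarModule ℂ X]

instance completionStarRing : StarRing (Completion X) where
  star := Completion.map star
  star_involutive x := by
    induction x using Completion.induction_on with
    | hp =>
      have h : Continuous (Completion.map (star : X → X)) := Completion.continuous_map
      exact isClosed_eq (h.comp h) continuous_id
    | ih x =>
      rw [Completion.map_coe star_isometry.uniformContinuous,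
        Completion.map_coe star_isometry.uniformContinuous, star_star]
  star_mul x y := by
    induction x, y using Completion.induction_on₂ with
    | hp =>
      have h : Continuous (Completion.map (star : X → X)) := Completion.continuous_map
      exact isClosed_eq (h.comp continuous_mul)
        ((h.comp continuous_snd).mul (h.comp continuous_fst))
    | ih x y =>
      simp only [← Completion.coe_mul, Completion.map_coe star_isometry.uniformContinuous,
        star_mul]
  star_add x y := by
    induction x, y using Completion.induction_on₂ with
    | hp =>
      have h : Continuous (Completion.map (star : X → X)) := Completion.continuous_map
      exact isClosed_eq (h.comp continuous_add)
        ((h.comp continuous_fst).add (h.comp continuous_snd))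
    | ih x y =>
      simp only [← Completion.coe_add, Completion.map_coe star_isometry.uniformContinuous,
        star_add]

theorem completion_star_coe (x : X) : star (x : Completion X) = ((star x : X) : Completion X) :=
  Completion.map_coe star_isometry.uniformContinuous x

theorem completion_continuous_star : Continuous (star : Completion X → Completion X) :=
  Completion.continuous_map

instance completionCStarAlgebra : CStarAlgebra (Completion X) where
  norm_mul_self_le x := by
    induction x using Completion.induction_on with
    | hp =>
      exact isClosed_le (by fun_prop)
        ((completion_continuous_star.mul continuous_id).norm)
    | ih x =>
      simp only [completion_star_coe, ← Completion.coe_mul, Completion.norm_coe]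
      exact CStarRing.norm_mul_self_le x
  norm_smul_le c x := norm_smul_le c x
  star_smul c x := by
    induction x using Completion.induction_on with
    | hp =>
      exact isClosed_eq (completion_continuous_star.comp (continuous_const_smul c))
        ((continuous_const_smul (star c)).comp completion_continuous_star)
    | ih x => simp only [completion_star_coe, ← Completion.coe_smul, star_smul]

/-- The inclusion of a pre-`C*`-algebra into its completion. -/
def toCompletionStarHom : X →⋆ₙₐ[ℂ] Completion X where
  toFun x := x
  map_smul' c x := Completion.coe_smul c x
  map_zero' := rfl
  map_add' := Completion.coe_add
  map_mul' := Completion.coe_mul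
  map_star' x := (completion_star_coe x).symm

theorem norm_toCompletionStarHom (x : X) : ‖toCompletionStarHom x‖ = ‖x‖ :=
  Completion.norm_coe x

end CompletionOfPreCStar

/-! ### `C*`-seminorms and the `C*`-algebras they generate -/

namespace IsCStarSeminorm

section basic
variable {A : Type*} [NonUnitalRing A] [StarRing A] [Module ℂ A] {p : A → ℝ}
  (hp : IsCStarSeminorm p)
include hp

theorem map_zero : p 0 = 0 := by simpa using hp.smul_eq 0 0

theorem map_neg (a : A) : p (-a) = p a := by simpa using hp.smul_eq (-1) a

theorem nonneg (a : A) : 0 ≤ p a := by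
  have := hp.add_le a (-a)
  rw [add_neg_cancel, hp.map_zero, hp.map_neg] at this
  linarith

/-- Cancel `p a` in `p a ^ 2 = p (a* a) ≤ p (a*) p a`. -/
theorem map_star (a : A) : p (star a) = p a := by
  have key : ∀ a, p a ≤ p (star a) := fun a => by
    rcases (hp.nonneg a).eq_or_lt with h | h
    · rw [← h]; exact hp.nonneg _
    · have h1 := hp.star_mul_self a
      have h2 := hp.mul_le (star a) a
      rw [h1, sq] at h2
      exact le_of_mul_le_mul_right h2 h
  exact le_antisymm (by simpa using key (star a)) (key a)

theorem sub_le (a b : A) : p (a - b) ≤ p a + p b := by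
  rw [sub_eq_add_neg, ← hp.map_neg b]; exact hp.add_le _ _

/-- A `C*`-seminorm as a bundled seminorm. -/
def toSeminorm : Seminorm ℂ A := Seminorm.of p hp.add_le hp.smul_eq

end basic

end IsCStarSeminorm

section Representation

variable {A : Type u} [NonUnitalRing A] [StarRing A] [Module ℂ A] {p : A → ℝ}

/-- The algebra `A` with the topology of the single `C*`-seminorm `p`. -/
@[nolint unusedArguments]
def SeminormedBy (_ : IsCStarSeminorm p) : Type u := A

variable (hp : IsCStarSeminorm p)

namespace SeminormedBy

instance : NonUnitalRing (SeminormedBy hp) := inferInstanceAs (NonUnitalRing A)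
instance : StarRing (SeminormedBy hp) := inferInstanceAs (StarRing A)
instance : Module ℂ (SeminormedBy hp) := inferInstanceAs (Module ℂ A)

instance : NonUnitalSeminormedRing (SeminormedBy hp) where
  toNorm := ⟨p⟩
  toNonUnitalRing := inferInstance
  toPseudoMetricSpace :=
    { dist := fun a b : A => p (-a + b)
      dist_self := fun a : A => show p (-a + a) = 0 by rw [neg_add_cancel, hp.map_zero]
      dist_comm := fun a b : A => show p (-a + b) = p (-b + a) by
        rw [← hp.map_neg, neg_add_rev, neg_neg]
      dist_triangle := fun a b c : A => show p (-a + c) ≤ p (-a + b) + p (-b + c) by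
        have h : -a + c = (-a + b) + (-b + c) := by abel
        rw [h]
        exact hp.add_le _ _ }
  dist_eq _ _ := rfl
  norm_mul_le := hp.mul_le

instance [IsScalarTower ℂ A A] : IsScalarTower ℂ (SeminormedBy hp) (SeminormedBy hp) :=
  inferInstanceAs (IsScalarTower ℂ A A)
instance [SMulCommClass ℂ A A] : SMulCommClass ℂ (SeminormedBy hp) (SeminormedBy hp) :=
  inferInstanceAs (SMulCommClass ℂ A A)
instance [StarModule ℂ A] : StarModule ℂ (SeminormedBy hp) :=
  inferInstanceAs (StarModule ℂ A)

instance : NormedSpace ℂ (SeminormedBy hp) where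
  norm_smul_le c a := (hp.smul_eq c a).le

theorem inseparable_star {a b : SeminormedBy hp} (h : Inseparable a b) :
    Inseparable (star a) (star b) := by
  rw [Metric.inseparable_iff, dist_eq_norm] at h ⊢
  rw [← star_sub]
  exact (hp.map_star _).trans h

instance : StarRing (SeparationQuotient (SeminormedBy hp)) where
  star := SeparationQuotient.lift (fun a => SeparationQuotient.mk (star a)) fun _ _ h =>
    SeparationQuotient.mk_eq_mk.2 (inseparable_star hp h)
  star_involutive := SeparationQuotient.surjective_mk.forall.2 fun a =>
    congrArg SeparationQuotient.mk (star_star a)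
  star_mul := SeparationQuotient.surjective_mk.forall₂.2 fun a b =>
    congrArg SeparationQuotient.mk (star_mul a b)
  star_add := SeparationQuotient.surjective_mk.forall₂.2 fun a b =>
    congrArg SeparationQuotient.mk (star_add a b)

instance : CStarRing (SeparationQuotient (SeminormedBy hp)) where
  norm_mul_self_le := SeparationQuotient.surjective_mk.forall.2 fun a =>
    ((sq (p a)).symm.trans (hp.star_mul_self a).symm).le

instance [StarModule ℂ A] : StarModule ℂ (SeparationQuotient (SeminormedBy hp)) where
  star_smul c := SeparationQuotient.surjective_mk.forall.2 fun a =>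
    congrArg SeparationQuotient.mk (star_smul c a)

instance [IsScalarTower ℂ A A] : IsScalarTower ℂ (SeparationQuotient (SeminormedBy hp))
    (SeparationQuotient (SeminormedBy hp)) where
  smul_assoc c := SeparationQuotient.surjective_mk.forall₂.2 fun a b =>
    congrArg SeparationQuotient.mk (smul_assoc c a b)

instance [SMulCommClass ℂ A A] : SMulCommClass ℂ (SeparationQuotient (SeminormedBy hp))
    (SeparationQuotient (SeminormedBy hp)) where
  smul_comm c := SeparationQuotient.surjective_mk.forall₂.2 fun a b =>
    congrArg SeparationQuotient.mk (smul_comm c a b)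

end SeminormedBy

variable [IsScalarTower ℂ A A] [SMulCommClass ℂ A A] [StarModule ℂ A]

/-- The quotient of `A` by the kernel of `p`. -/
abbrev SeminormQuotient : Type u := SeparationQuotient (SeminormedBy hp)

/-- The quotient map as a `*`-homomorphism. -/
def toQuotient : A →⋆ₙₐ[ℂ] SeminormQuotient hp where
  toFun a := SeparationQuotient.mk (a : SeminormedBy hp)
  map_smul' _ _ := rfl
  map_zero' := rfl
  map_add' _ _ := rfl
  map_mul' _ _ := rfl
  map_star' _ := rfl

variable (p) in
/-- A `*`-homomorphism `hom` from `A` to a unital `C*`-algebra with `‖hom a‖ = p a`. -/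
structure CStarRepresentation where
  carrier : Type u
  [algebra : CStarAlgebra carrier]
  [order : PartialOrder carrier]
  [starOrdered : StarOrderedRing carrier]
  hom : A →⋆ₙₐ[ℂ] carrier
  norm_hom : ∀ a, ‖hom a‖ = p a

/-- An isometric `*`-homomorphism to a `C*`-algebra with its spectral order. -/
def CStarRepresentation.ofHom {B : Type u} [CStarAlgebra B] (f : A →⋆ₙₐ[ℂ] B)
    (hf : ∀ a, ‖f a‖ = p a) : CStarRepresentation p :=
  letI := CStarAlgebra.spectralOrder B
  { carrier := B
    starOrdered := CStarAlgebra.spectralOrderedRing B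
    hom := f
    norm_hom := hf }

/-- The representation of `A` in the completion of the unitization of the quotient of `A` by the
kernel of `p`. -/
def hullRepresentation : CStarRepresentation p :=
  .ofHom ((toCompletionStarHom (X := Unitization ℂ (SeminormQuotient hp))).comp
      ((Unitization.inrNonUnitalStarAlgHom ℂ (SeminormQuotient hp)).comp (toQuotient hp)))
    fun a => (norm_toCompletionStarHom _).trans (Unitization.norm_inr (toQuotient hp a))

/-- A unital `C*`-algebra which contains the quotient of `A` by the kernel of `p`. -/
def CStarHull : Type u := (hullRepresentation hp).carrier

instance : CStarAlgebra (CStarHull hp) := (hullRepresentation hp).algebra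
instance : PartialOrder (CStarHull hp) := (hullRepresentation hp).order
instance : StarOrderedRing (CStarHull hp) := (hullRepresentation hp).starOrdered

/-- The canonical `*`-homomorphism to the `C*`-algebra `CStarHull hp`. -/
def toHull : A →⋆ₙₐ[ℂ] CStarHull hp := (hullRepresentation hp).hom

theorem norm_toHull (a : A) : ‖toHull hp a‖ = p a := (hullRepresentation hp).norm_hom a

end Representation

/-! ### Seminorms of vectors -/

/-- Used where `b` is a seminorm value that may vanish, so that only the positive number `b + ε` is
ever divided by. -/
theorem le_mul_of_forall_pos_le {a b c : ℝ} (hc : 0 ≤ c) (h : ∀ ε > 0, a ≤ (b + ε) * c) :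
    a ≤ b * c := by
  refine le_of_forall_pos_le_add fun ε hε => ?_
  have h1 := h (ε / (c + 1)) (by positivity)
  have h2 : ε / (c + 1) * c ≤ ε := by
    rw [div_mul_eq_mul_div, div_le_iff₀ (by positivity)]
    nlinarith
  linarith

section Elementary

variable {A E : Type*} [NonUnitalRing A] [StarRing A] [Module ℂ A]
  [AddCommGroup E] [Module ℂ E] [InnerModule A E]

theorem sub_inn (ξ η ζ : E) :
    (InnerModule.inn (ξ - η) ζ : A) = InnerModule.inn ξ ζ - InnerModule.inn η ζ := by
  rw [← InnerModule.star_inn, inn_sub, star_sub, InnerModule.star_inn, InnerModule.star_inn]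

theorem inn_neg (ξ η : E) : (InnerModule.inn ξ (-η) : A) = -InnerModule.inn ξ η := by
  rw [← zero_sub, inn_sub, inn_zero, zero_sub]

theorem act_sub (ξ : E) (a b : A) :
    InnerModule.act ξ (a - b) = InnerModule.act ξ a - InnerModule.act ξ b := by
  rw [eq_sub_iff_add_eq, ← InnerModule.act_add, sub_add_cancel]

variable {p : A → ℝ} (hp : IsCStarSeminorm p)

theorem vecSeminorm_nonneg (p : A → ℝ) (ξ : E) : 0 ≤ vecSeminorm p ξ := Real.sqrt_nonneg _

include hp

theorem vecSeminorm_sq (ξ : E) : vecSeminorm p ξ ^ 2 = p (InnerModule.inn ξ ξ) :=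
  Real.sq_sqrt (hp.nonneg _)

theorem vecSeminorm_zero : vecSeminorm p (0 : E) = 0 := by
  rw [vecSeminorm, inn_zero, hp.map_zero, Real.sqrt_zero]

theorem vecSeminorm_smul [StarModule ℂ A] (c : ℂ) (ξ : E) :
    vecSeminorm p (c • ξ) = ‖c‖ * vecSeminorm p ξ := by
  rw [vecSeminorm, InnerModule.inn_smul, smul_inn, hp.smul_eq, hp.smul_eq, norm_star,
    ← mul_assoc, Real.sqrt_mul (by positivity), Real.sqrt_mul_self (norm_nonneg _)]
  rfl

theorem vecSeminorm_neg (ξ : E) : vecSeminorm p (-ξ) = vecSeminorm p ξ := by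
  rw [vecSeminorm, inn_neg, ← InnerModule.star_inn, inn_neg, star_neg, neg_neg,
    InnerModule.star_inn]
  rfl

theorem vecSeminorm_sub_rev (ξ η : E) : vecSeminorm p (ξ - η) = vecSeminorm p (η - ξ) := by
  rw [← vecSeminorm_neg hp, neg_sub]

theorem vecSeminorm_act_le (ξ : E) (a : A) :
    vecSeminorm p (InnerModule.act ξ a) ≤ vecSeminorm p ξ * p a := by
  refine Real.sqrt_le_iff.2 ⟨mul_nonneg (vecSeminorm_nonneg _ _) (hp.nonneg _), ?_⟩
  rw [InnerModule.inn_act, act_inn, mul_pow, vecSeminorm_sq hp]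
  calc p (star a * InnerModule.inn ξ ξ * a) ≤ p (star a) * p (InnerModule.inn ξ ξ) * p a :=
        (hp.mul_le _ _).trans (mul_le_mul_of_nonneg_right (hp.mul_le _ _) (hp.nonneg _))
    _ = p (InnerModule.inn ξ ξ) * p a ^ 2 := by rw [hp.map_star]; ring

end Elementary

/-! ### Cauchy–Schwarz and the moment inequality -/

section Positive

variable {A E F : Type*} [NonUnitalRing A] [StarRing A] [Module ℂ A]
  [IsScalarTower ℂ A A] [SMulCommClass ℂ A A] [StarModule ℂ A]
  [AddCommGroup E] [Module ℂ E] [InnerModule A E]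
  [AddCommGroup F] [Module ℂ F] [InnerModule A F]
  {p : A → ℝ} (hp : IsCStarSeminorm p)

variable (E) in
/-- The inner squares of vectors of `E` have positive images in the `C*`-algebra generated by
`A` and the seminorm `p`. -/
def IsPositiveAt : Prop := ∀ ξ : E, 0 ≤ toHull hp (InnerModule.inn ξ ξ : A)

theorem isPositiveAt_of_eq_star_mul_self
    (h : ∀ ξ : E, ∃ b : A, InnerModule.inn ξ ξ = star b * b) : IsPositiveAt E hp := fun ξ => by
  obtain ⟨b, hb⟩ := h ξ
  rw [hb, map_mul, map_star]
  exact star_mul_self_nonneg _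

namespace IsPositiveAt

variable {hp} (hE : IsPositiveAt E hp) (hF : IsPositiveAt F hp)
include hE

/-- Cauchy–Schwarz. With `x = ⟨ξ, η⟩` and `r = p ⟨ξ, ξ⟩ + ε`, positivity of the inner square of `ξ x
- r η` reads `0 ≤ x* ⟨ξ, ξ⟩ x - 2r x* x + r² ⟨η, η⟩`. Since `⟨ξ, ξ⟩ ≤ r` in the hull, `x* x ≤ r ⟨η,
η⟩`, and norms are taken. -/
theorem inn_le (ξ η : E) :
    p (InnerModule.inn ξ η) ≤ vecSeminorm p ξ * vecSeminorm p η := by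
  set π := toHull hp with hπ
  set x : A := InnerModule.inn ξ η with hx
  have key : ∀ ε > 0, p x ^ 2 ≤ (p (InnerModule.inn ξ ξ) + ε) * p (InnerModule.inn η η) := by
    intro ε hε
    set r : ℝ := p (InnerModule.inn ξ ξ) + ε with hr
    have hr0 : 0 < r := add_pos_of_nonneg_of_pos (hp.nonneg _) hε
    have h1 := hE (InnerModule.act ξ x - (r : ℂ) • η)
    have h2 : (InnerModule.inn (InnerModule.act ξ x - (r : ℂ) • η)
        (InnerModule.act ξ x - (r : ℂ) • η) : A) = star x * InnerModule.inn ξ ξ * x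
          - (2 * r : ℂ) • (star x * x) + (r ^ 2 : ℂ) • InnerModule.inn η η := by
      have hx' : star x = InnerModule.inn η ξ := InnerModule.star_inn _ _
      have hr' : star (r : ℂ) = r := Complex.conj_ofReal r
      simp only [inn_sub, sub_inn, InnerModule.inn_act, act_inn, InnerModule.inn_smul, smul_inn,
        ← hx, ← hx', hr']
      rw [sub_mul, smul_mul_assoc]
      module
    rw [h2, map_add, map_sub, map_mul, map_mul, map_smul, map_smul, map_mul, map_star,
      ← hπ] at h1
    have h3 : star (π x) * π (InnerModule.inn ξ ξ) * π x ≤ r • (star (π x) * π x) := by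
      refine (CStarAlgebra.star_left_conjugate_le_norm_smul
        (IsSelfAdjoint.of_nonneg (hE ξ))).trans ?_
      refine smul_le_smul_of_nonneg_right ?_ (star_mul_self_nonneg _)
      rw [norm_toHull, hr]
      linarith
    have h4 : r • (star (π x) * π x) ≤ r • (r • π (InnerModule.inn η η)) := by
      have e1 : (2 * r : ℂ) • (star (π x) * π x) = (2 * r) • (star (π x) * π x) := by
        rw [← Complex.coe_smul]; push_cast; rfl
      have e2 : (r ^ 2 : ℂ) • π (InnerModule.inn η η) = r ^ 2 • π (InnerModule.inn η η) := by
        rw [← Complex.coe_smul]; push_cast; rfl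
      rw [e1, e2] at h1
      have h5 := add_le_add h1 (sub_nonneg.2 h3)
      rw [zero_add] at h5
      rw [← sub_nonneg]
      refine h5.trans (le_of_eq ?_)
      module
    have h5 : star (π x) * π x ≤ r • π (InnerModule.inn η η) := by
      have := smul_le_smul_of_nonneg_left h4 (inv_nonneg.2 hr0.le)
      rwa [inv_smul_smul₀ hr0.ne', inv_smul_smul₀ hr0.ne'] at this
    have h6 := CStarAlgebra.norm_le_norm_of_nonneg_of_le (star_mul_self_nonneg _) h5
    rw [CStarRing.norm_star_mul_self, norm_smul, norm_toHull, norm_toHull, Real.norm_of_nonneg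
      hr0.le] at h6
    rw [sq]
    exact h6
  have h := le_mul_of_forall_pos_le (hp.nonneg _) key
  rw [← vecSeminorm_sq hp, ← vecSeminorm_sq hp, ← mul_pow] at h
  exact le_of_sq_le_sq h (by simp [mul_nonneg, vecSeminorm_nonneg])

theorem add_le (ξ η : E) :
    vecSeminorm p (ξ + η) ≤ vecSeminorm p ξ + vecSeminorm p η := by
  refine Real.sqrt_le_iff.2
    ⟨add_nonneg (vecSeminorm_nonneg _ _) (vecSeminorm_nonneg _ _), ?_⟩
  rw [add_inn, InnerModule.inn_add, InnerModule.inn_add]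
  have h1 := hE.inn_le ξ η
  have h2 := hE.inn_le η ξ
  have h3 := vecSeminorm_sq hp ξ
  have h4 := vecSeminorm_sq hp η
  have h5 := hp.add_le (InnerModule.inn ξ ξ + InnerModule.inn ξ η : A)
    (InnerModule.inn η ξ + InnerModule.inn η η)
  have h6 := hp.add_le (InnerModule.inn ξ ξ : A) (InnerModule.inn ξ η)
  have h7 := hp.add_le (InnerModule.inn η ξ : A) (InnerModule.inn η η)
  nlinarith

theorem sub_le (ξ η : E) : vecSeminorm p (ξ - η) ≤ vecSeminorm p ξ + vecSeminorm p η := by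
  rw [sub_eq_add_neg, ← vecSeminorm_neg hp η]
  exact hE.add_le _ _

theorem sub_le_sub_add_sub (ξ η ζ : E) :
    vecSeminorm p (ξ - ζ) ≤ vecSeminorm p (ξ - η) + vecSeminorm p (η - ζ) := by
  rw [← sub_add_sub_cancel ξ η ζ]
  exact hE.add_le _ _

include hF

/-- With `D = T* T`, the difference of the two sides is an inner square: of `t Dᵐ ξ - Dᵐ⁺¹ ξ` in `E`
if `n = 2m`, and of the image of that vector under `T` in `F` if `n = 2m + 1`. -/
theorem two_smul_le (T : Adjointable A E F) (ξ : E) (t : ℝ) (n : ℕ) :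
    (2 * t) • toHull hp (InnerModule.inn ξ (((T.adj.comp T) ^ (n + 1)) ξ)) ≤
      t ^ 2 • toHull hp (InnerModule.inn ξ (((T.adj.comp T) ^ n) ξ)) +
        toHull hp (InnerModule.inn ξ (((T.adj.comp T) ^ (n + 2)) ξ)) := by
  set D : Adjointable A E E := T.adj.comp T with hD
  have hDadj : D.adj = D := by rw [hD, Adjointable.adj_comp, Adjointable.adj_adj]
  have hpow : ∀ m k : ℕ, (InnerModule.inn ((D ^ m) ξ) ((D ^ k) ξ) : A) =
      InnerModule.inn ξ ((D ^ (m + k)) ξ) := by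
    intro m
    induction m with
    | zero => intro k; rw [pow_zero, zero_add]; rfl
    | succ m ih =>
      intro k
      rw [pow_succ', Adjointable.mul_apply, Adjointable.inn_adj, hDadj, ← Adjointable.mul_apply,
        ← pow_succ', ih]
      congr 3
      ring
  have hpow' : ∀ m k : ℕ, (InnerModule.inn (T ((D ^ m) ξ)) (T ((D ^ k) ξ)) : A) =
      InnerModule.inn ξ ((D ^ (m + k + 1)) ξ) := by
    intro m k
    rw [Adjointable.inn_adj, ← Adjointable.comp_apply, ← hD, ← Adjointable.mul_apply,
      ← pow_succ', hpow, add_assoc]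
  have ht : star (t : ℂ) = t := Complex.conj_ofReal t
  have hcast : ∀ x : CStarHull hp, (t : ℂ) • x = t • x := fun x => Complex.coe_smul t x
  rw [← sub_nonneg]
  obtain ⟨m, rfl | rfl⟩ := n.even_or_odd'
  · refine (hE ((t : ℂ) • (D ^ m) ξ - (D ^ (m + 1)) ξ)).trans (le_of_eq ?_)
    simp only [inn_sub, sub_inn, InnerModule.inn_smul, smul_inn, ht, hpow, map_sub, map_smul,
      hcast]
    rw [show m + m = 2 * m by ring, show m + (m + 1) = 2 * m + 1 by ring,
      show m + 1 + m = 2 * m + 1 by ring, show m + 1 + (m + 1) = 2 * m + 2 by ring]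
    module
  · refine (hF ((t : ℂ) • T ((D ^ m) ξ) - T ((D ^ (m + 1)) ξ))).trans (le_of_eq ?_)
    simp only [inn_sub, sub_inn, InnerModule.inn_smul, smul_inn, ht, hpow', map_sub, map_smul,
      hcast]
    rw [show m + m + 1 = 2 * m + 1 by ring, show m + (m + 1) + 1 = 2 * m + 1 + 1 by ring,
      show m + 1 + m + 1 = 2 * m + 1 + 1 by ring,
      show m + 1 + (m + 1) + 1 = 2 * m + 1 + 2 by ring]
    module

/-- The rescaled moments `g n = t⁻ⁿ ⟨ξ, (T* T)ⁿ ξ⟩` form a convex sequence by `two_smul_le` and tend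
to `0` because `r < t`. Their increasing differences also tend to `0`, so all are `≤ 0`; in
particular `g 1 ≤ g 0`. The constant `C` plays no role in the conclusion. -/
theorem inn_map_le_of_lt (T : Adjointable A E F) (ξ : E) {C r t : ℝ} (hr : 0 ≤ r) (ht : r < t)
    (hb : ∀ n : ℕ, p (InnerModule.inn ξ (((T.adj.comp T) ^ n) ξ)) ≤ C * r ^ n) :
    toHull hp (InnerModule.inn (T ξ) (T ξ)) ≤ t • toHull hp (InnerModule.inn ξ ξ) := by
  have ht0 : 0 < t := hr.trans_lt ht
  set h : ℕ → CStarHull hp :=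
    fun n => toHull hp (InnerModule.inn ξ (((T.adj.comp T) ^ n) ξ)) with hh
  set g : ℕ → CStarHull hp := fun n => (t⁻¹ ^ n) • h n with hg
  have hconv : ∀ n, g (n + 1) - g n ≤ g (n + 2) - g (n + 1) := by
    intro n
    have h1 := smul_le_smul_of_nonneg_left (hE.two_smul_le hF T ξ t n)
      (by positivity : 0 ≤ t⁻¹ ^ (n + 2))
    rw [← sub_nonneg] at h1 ⊢
    refine h1.trans (le_of_eq ?_)
    change (t⁻¹ ^ (n + 2)) • (t ^ 2 • h n + h (n + 2)) - (t⁻¹ ^ (n + 2)) • (2 * t) • h (n + 1) =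
      t⁻¹ ^ (n + 2) • h (n + 2) - t⁻¹ ^ (n + 1) • h (n + 1) -
        (t⁻¹ ^ (n + 1) • h (n + 1) - t⁻¹ ^ n • h n)
    have e1 : t⁻¹ ^ n = t⁻¹ ^ (n + 2) * t ^ 2 := by
      rw [pow_add, mul_assoc, ← mul_pow, inv_mul_cancel₀ ht0.ne', one_pow, mul_one]
    have e2 : t⁻¹ ^ (n + 1) = t⁻¹ ^ (n + 2) * t := by
      rw [pow_succ t⁻¹ (n + 1), mul_assoc, inv_mul_cancel₀ ht0.ne', mul_one]
    rw [e1, e2]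
    module
  have hlim : Tendsto g atTop (𝓝 0) := by
    have hlim0 : Tendsto (fun n => C * (r / t) ^ n) atTop (𝓝 0) := by
      have := (tendsto_pow_atTop_nhds_zero_of_lt_one (div_nonneg hr ht0.le)
        ((div_lt_one ht0).2 ht)).const_mul C
      rwa [mul_zero] at this
    refine squeeze_zero_norm (fun n => ?_) hlim0
    rw [hg, norm_smul, norm_pow, Real.norm_of_nonneg (inv_nonneg.2 ht0.le), norm_toHull]
    refine (mul_le_mul_of_nonneg_left (hb n) (by positivity)).trans (le_of_eq ?_)
    rw [div_eq_mul_inv, mul_pow]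
    ring
  have hmono : Monotone fun n => g (n + 1) - g n := monotone_nat_of_le_succ hconv
  have hd : Tendsto (fun n => g (n + 1) - g n) atTop (𝓝 0) := by
    have := (hlim.comp (tendsto_add_atTop_nat 1)).sub hlim
    rwa [sub_zero] at this
  have h0 := hmono.ge_of_tendsto hd 0
  have h1 : t⁻¹ • h 1 ≤ h 0 := by
    have := sub_nonpos.1 h0
    simpa [hg] using this
  have h2 := smul_le_smul_of_nonneg_left h1 ht0.le
  rw [smul_inv_smul₀ ht0.ne'] at h2
  have h3 : h 1 = toHull hp (InnerModule.inn (T ξ) (T ξ)) := by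
    rw [hh]
    beta_reduce
    rw [pow_one, Adjointable.comp_apply, Adjointable.inn_adj]
  rw [← h3]
  exact h2

theorem inn_map_le (T : Adjointable A E F) (ξ : E) {C r : ℝ} (hr : 0 ≤ r)
    (hb : ∀ n : ℕ, p (InnerModule.inn ξ (((T.adj.comp T) ^ n) ξ)) ≤ C * r ^ n) :
    toHull hp (InnerModule.inn (T ξ) (T ξ)) ≤ r • toHull hp (InnerModule.inn ξ ξ) := by
  have h1 : Tendsto (fun t : ℝ => t • toHull hp (InnerModule.inn ξ ξ : A)) (𝓝[>] r)
      (𝓝 (r • toHull hp (InnerModule.inn ξ ξ))) :=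
    ((continuous_id.smul continuous_const).tendsto r).mono_left nhdsWithin_le_nhds
  refine ge_of_tendsto h1 ?_
  filter_upwards [self_mem_nhdsWithin] with t ht
  exact hE.inn_map_le_of_lt hF T ξ hr ht hb

theorem map_le (T : Adjointable A E F) (ξ : E) {C r : ℝ} (hr : 0 ≤ r)
    (hb : ∀ n : ℕ, p (InnerModule.inn ξ (((T.adj.comp T) ^ n) ξ)) ≤ C * r ^ n) :
    vecSeminorm p (T ξ) ^ 2 ≤ r * vecSeminorm p ξ ^ 2 := by
  have h := CStarAlgebra.norm_le_norm_of_nonneg_of_le (hF (T ξ)) (hE.inn_map_le hF T ξ hr hb)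
  rwa [norm_smul, norm_toHull, norm_toHull, Real.norm_of_nonneg hr, ← vecSeminorm_sq hp,
    ← vecSeminorm_sq hp] at h

end IsPositiveAt

end Positive

/-! ### Completeness by seminorms, and joins of `C*`-seminorms -/

/-- One direction extracts limits from the completeness of `A`; the other proves that the operator
spaces are complete. -/
theorem completeSpace_iff_of_le_nhds_zero_iff {X ι : Type*} [AddCommGroup X] [TopologicalSpace X]
    [IsTopologicalAddGroup X] {N : ι → X → ℝ} (hN0 : ∀ i x, 0 ≤ N i x)
    (hN : ∀ l : Filter X, l ≤ 𝓝 0 ↔ ∀ i, Tendsto (N i) l (𝓝 0)) :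
    @CompleteSpace X (IsTopologicalAddGroup.rightUniformSpace X) ↔
      ∀ f : Filter X, f.NeBot →
        (∀ i, ∀ ε > 0, ∃ s ∈ f, ∀ x ∈ s, ∀ y ∈ s, N i (x - y) < ε) →
        ∃ x, ∀ i, Tendsto (fun y => N i (y - x)) f (𝓝 0) := by
  let _ := IsTopologicalAddGroup.rightUniformSpace X
  have : IsUniformAddGroup X := isUniformAddGroup_of_addCommGroup
  have hle : ∀ (f : Filter X) (x : X),
      f ≤ 𝓝 x ↔ ∀ i, Tendsto (fun y => N i (y - x)) f (𝓝 0) := by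
    intro f x
    have h : f ≤ 𝓝 x ↔ map (fun y => y - x) f ≤ 𝓝 0 :=
      (tendsto_sub_nhds_zero_iff (u := id) (l := f)).symm
    rw [h, hN]
    rfl
  have hcauchy : ∀ f : Filter X, f.NeBot → (Cauchy f ↔
      ∀ i, ∀ ε > 0, ∃ s ∈ f, ∀ x ∈ s, ∀ y ∈ s, N i (x - y) < ε) := by
    intro f hf
    rw [Cauchy, uniformity_eq_comap_nhds_zero, ← map_le_iff_le_comap, hN]
    simp only [hf, true_and]
    refine forall_congr' fun i => ?_
    rw [tendsto_map'_iff, Metric.tendsto_nhds]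
    refine forall₂_congr fun ε _ => ?_
    rw [eventually_iff, mem_prod_same_iff]
    refine exists_congr fun s => and_congr_right fun _ => ?_
    rw [Set.prod_subset_iff]
    simp only [Set.mem_ofPred_eq, Function.comp, dist_zero_right, Real.norm_of_nonneg (hN0 _ _)]
    exact ⟨fun h x hx y hy => h y hy x hx, fun h x hx y hy => h y hy x hx⟩
  constructor
  · intro _ f hf hs
    obtain ⟨x, hx⟩ := CompleteSpace.complete ((hcauchy f hf).2 hs)
    exact ⟨x, (hle f x).1 hx⟩
  · intro h
    refine ⟨fun {f} hf => ?_⟩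
    obtain ⟨x, hx⟩ := h f hf.1 ((hcauchy f hf.1).1 hf)
    exact ⟨x, (hle f x).2 hx⟩

namespace IsCStarSeminorm

variable {A : Type*} [NonUnitalRing A] [StarRing A] [Module ℂ A]

/-- Makes the continuous `C*`-seminorms a directed set. -/
theorem sup {p q : A → ℝ} (hp : IsCStarSeminorm p) (hq : IsCStarSeminorm q) :
    IsCStarSeminorm fun a => max (p a) (q a) where
  add_le a b := max_le
    ((hp.add_le a b).trans (add_le_add (le_max_left _ _) (le_max_left _ _)))
    ((hq.add_le a b).trans (add_le_add (le_max_right _ _) (le_max_right _ _)))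
  smul_eq c a := by rw [hp.smul_eq, hq.smul_eq, mul_max_of_nonneg _ _ (norm_nonneg c)]
  mul_le a b := max_le
    ((hp.mul_le a b).trans (mul_le_mul (le_max_left _ _) (le_max_left _ _) (hp.nonneg _)
      (le_max_of_le_left (hp.nonneg _))))
    ((hq.mul_le a b).trans (mul_le_mul (le_max_right _ _) (le_max_right _ _) (hq.nonneg _)
      (le_max_of_le_left (hp.nonneg _))))
  star_mul_self a := by
    rw [hp.star_mul_self, hq.star_mul_self]
    rcases le_total (p a) (q a) with h | h
    · rw [max_eq_right h, max_eq_right (pow_le_pow_left₀ (hp.nonneg _) h 2)]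
    · rw [max_eq_left h, max_eq_left (pow_le_pow_left₀ (hq.nonneg _) h 2)]

theorem zero : IsCStarSeminorm fun _ : A => (0 : ℝ) where
  add_le _ _ := by simp
  smul_eq _ _ := by simp
  mul_le _ _ := by simp
  star_mul_self _ := by simp

end IsCStarSeminorm

section contSeminorms

variable {A : Type*} [NonUnitalRing A] [StarRing A] [Module ℂ A] [TopologicalSpace A]

theorem sup_mem_contSeminorms {p q : A → ℝ} (hp : p ∈ contSeminorms A)
    (hq : q ∈ contSeminorms A) : (fun a => max (p a) (q a)) ∈ contSeminorms A :=
  ⟨hp.1.sup hq.1, hp.2.max hq.2⟩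

theorem zero_mem_contSeminorms : (fun _ : A => (0 : ℝ)) ∈ contSeminorms A :=
  ⟨.zero, continuous_const⟩

end contSeminorms

/-! ### The element `(1 + k)⁻¹` of a `C*`-algebra -/

section Resolvent

variable {B : Type*} [CStarAlgebra B] [PartialOrder B] [StarOrderedRing B]

/-- The inverse of `1 + k`, for a positive element `k` of a `C*`-algebra. -/
def invOneAdd (k : B) : B := cfc (fun t : ℝ => (1 + t)⁻¹) k

variable {k : B} (hk : 0 ≤ k)
include hk

theorem continuousOn_inv_one_add : ContinuousOn (fun t : ℝ => (1 + t)⁻¹) (spectrum ℝ k) := by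
  refine ContinuousOn.inv₀ (by fun_prop) fun t ht => ?_
  have := spectrum_nonneg_of_nonneg hk ht
  positivity

theorem invOneAdd_mul : invOneAdd k * (1 + k) = 1 := by
  have hsa : IsSelfAdjoint k := .of_nonneg hk
  have h1 : (1 + k) = cfc (fun t : ℝ => 1 + t) k := by
    rw [cfc_const_add 1 _ k (by fun_prop), cfc_id' ℝ k, map_one]
  rw [invOneAdd, h1, ← cfc_mul _ _ k (continuousOn_inv_one_add hk) (by fun_prop)]
  refine Eq.trans (cfc_congr fun t ht => ?_) (cfc_one ℝ k)
  have := spectrum_nonneg_of_nonneg hk ht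
  have : (1 + t) ≠ 0 := by positivity
  simp [this]

theorem invOneAdd_sub_one : invOneAdd k - 1 = cfc (fun t : ℝ => (1 + t)⁻¹ - 1) k := by
  have hsa : IsSelfAdjoint k := .of_nonneg hk
  rw [cfc_sub _ _ k (continuousOn_inv_one_add hk) (by fun_prop), cfc_const_one ℝ k]
  rfl

theorem isSelfAdjoint_invOneAdd : IsSelfAdjoint (invOneAdd k) := cfc_predicate _ k

theorem norm_invOneAdd_le : ‖invOneAdd k‖ ≤ 1 := by
  refine norm_cfc_le zero_le_one fun t ht => ?_
  have := spectrum_nonneg_of_nonneg hk ht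
  rw [Real.norm_of_nonneg (by positivity)]
  exact inv_le_one_of_one_le₀ (by linarith)

theorem norm_invOneAdd_sub_one_le : ‖invOneAdd k - 1‖ ≤ 1 := by
  rw [invOneAdd_sub_one hk]
  refine norm_cfc_le zero_le_one fun t ht => ?_
  have := spectrum_nonneg_of_nonneg hk ht
  have h1 : (1 + t)⁻¹ ≤ 1 := inv_le_one_of_one_le₀ (by linarith)
  have h2 : 0 ≤ (1 + t)⁻¹ := by positivity
  rw [Real.norm_eq_abs, abs_le]
  constructor <;> linarith

/-- The function `t / (1 + t)²` on `[0, ∞)` has its maximum `1 / 4` at `t = 1`. The bound does not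
depend on `k`, which makes cutoffs uniform over all seminorms. -/
theorem norm_invOneAdd_conj_le : ‖invOneAdd k * k * invOneAdd k‖ ≤ 1 / 4 := by
  have hsa : IsSelfAdjoint k := .of_nonneg hk
  have h := continuousOn_inv_one_add hk
  have h1 : invOneAdd k * k * invOneAdd k = cfc (fun t : ℝ => (1 + t)⁻¹ * t * (1 + t)⁻¹) k := by
    rw [cfc_mul (fun t : ℝ => (1 + t)⁻¹ * t) _ k (h.mul (continuousOn_id' _)) h,
      cfc_mul _ _ k h (continuousOn_id' _), cfc_id' ℝ k]
    rfl
  rw [h1]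
  refine norm_cfc_le (by norm_num) fun t ht => ?_
  have := spectrum_nonneg_of_nonneg hk ht
  rw [Real.norm_of_nonneg (by positivity)]
  have h2 : (1 + t)⁻¹ * t * (1 + t)⁻¹ = t / (1 + t) ^ 2 := by field_simp
  rw [h2, div_le_div_iff₀ (by positivity) (by norm_num)]
  nlinarith [sq_nonneg (1 - t)]

/-- Here the function is `t³ / (1 + t)²`, which on `[0, 1]` is largest at `t = 1`. -/
theorem norm_invOneAdd_sub_one_conj_le (hk1 : ‖k‖ ≤ 1) :
    ‖(invOneAdd k - 1) * k * (invOneAdd k - 1)‖ ≤ 1 / 4 := by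
  have hsa : IsSelfAdjoint k := .of_nonneg hk
  have h : ContinuousOn (fun t : ℝ => (1 + t)⁻¹ - 1) (spectrum ℝ k) :=
    (continuousOn_inv_one_add hk).sub continuousOn_const
  have h1 : (invOneAdd k - 1) * k * (invOneAdd k - 1) =
      cfc (fun t : ℝ => ((1 + t)⁻¹ - 1) * t * ((1 + t)⁻¹ - 1)) k := by
    rw [cfc_mul (fun t : ℝ => ((1 + t)⁻¹ - 1) * t) _ k (h.mul (continuousOn_id' _)) h,
      cfc_mul _ _ k h (continuousOn_id' _), cfc_id' ℝ k,
      invOneAdd_sub_one hk]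
  rw [h1]
  nontriviality B
  refine norm_cfc_le (by norm_num) fun t ht => ?_
  have ht0 := spectrum_nonneg_of_nonneg hk ht
  have ht1 : t ≤ 1 :=
    (Real.le_norm_self t).trans ((spectrum.norm_le_norm_of_mem ht).trans hk1)
  have h2 : ((1 + t)⁻¹ - 1) * t * ((1 + t)⁻¹ - 1) = t ^ 3 / (1 + t) ^ 2 := by
    field_simp
    ring
  rw [h2, Real.norm_of_nonneg (by positivity), div_le_div_iff₀ (by positivity) (by norm_num)]
  nlinarith [mul_nonneg (sub_nonneg.2 ht1) ht0, mul_nonneg (mul_nonneg (sub_nonneg.2 ht1) ht0) ht0]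

/-- The hypothesis says `(1 + k) (1 + y) = 1`. This identifies the image in each hull of a
quasi-inverse found in `A`. -/
theorem eq_invOneAdd_sub_one {y : B} (hy : y + k + k * y = 0) : y = invOneAdd k - 1 := by
  have h1 : (1 + k) * (1 + y) = 1 := by
    calc (1 + k) * (1 + y) = 1 + (y + k + k * y) := by noncomm_ring
      _ = 1 := by rw [hy, add_zero]
  have h2 : 1 + y = invOneAdd k := by
    calc 1 + y = invOneAdd k * (1 + k) * (1 + y) := by rw [invOneAdd_mul hk, one_mul]
      _ = invOneAdd k := by rw [mul_assoc, h1, mul_one]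
  rw [← h2, add_sub_cancel_left]

/-- The function `(1 + t)⁻¹ - 1` vanishes at `0`, so the non-unital functional calculus applies and
stays inside `S`. -/
theorem invOneAdd_sub_one_mem {S : NonUnitalStarSubalgebra ℂ B} (hS : IsClosed (S : Set B))
    (hkS : k ∈ S) : invOneAdd k - 1 ∈ S := by
  have hsa : IsSelfAdjoint k := .of_nonneg hk
  have h : ContinuousOn (fun t : ℝ => (1 + t)⁻¹ - 1) (spectrum ℝ k) :=
    (continuousOn_inv_one_add hk).sub continuousOn_const
  have h' : ContinuousOn (fun t : ℝ => (1 + t)⁻¹ - 1) (quasispectrum ℝ k) := by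
    refine ContinuousOn.sub (ContinuousOn.inv₀ (by fun_prop) fun t ht => ?_) continuousOn_const
    have := quasispectrum_nonneg_of_nonneg k hk t ht
    positivity
  rw [invOneAdd_sub_one hk, ← cfcₙ_eq_cfc h' (by simp)]
  exact cfcₙ_mem (hs := hS) _ hkS

theorem invOneAdd_sub_one_add : (invOneAdd k - 1) + k + k * (invOneAdd k - 1) = 0 := by
  have hsa : IsSelfAdjoint k := .of_nonneg hk
  have h1 : (1 + k) * invOneAdd k = 1 := by
    have := congrArg star (invOneAdd_mul hk)
    rwa [star_mul, (isSelfAdjoint_invOneAdd hk).star_eq, star_add, star_one, hsa.star_eq] at this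
  calc (invOneAdd k - 1) + k + k * (invOneAdd k - 1) = (1 + k) * invOneAdd k - 1 := by
        noncomm_ring
    _ = 0 := by rw [h1, sub_self]

end Resolvent

/-! ### Quasi-inverses of positive elements in `A` -/

section QuasiInverse

variable {A : Type*} [NonUnitalRing A] [StarRing A] [Module ℂ A]
  [IsScalarTower ℂ A A] [SMulCommClass ℂ A A] [StarModule ℂ A]

theorem toHull_star_mul_self_nonneg {p : A → ℝ} (hp : IsCStarSeminorm p) (b : A) :
    0 ≤ toHull hp (star b * b) := by
  rw [map_mul, map_star]
  exact star_mul_self_nonneg _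

/-- In the hull, `x` is recovered from `(1 + b* b) x` by multiplying with the contraction `(1 + b*
b)⁻¹`. -/
theorem IsCStarSeminorm.le_add_mul {p : A → ℝ} (hp : IsCStarSeminorm p) (b x : A) :
    p x ≤ p (x + star b * b * x) := by
  have hk := toHull_star_mul_self_nonneg hp b
  set k := toHull hp (star b * b)
  have h : toHull hp x = invOneAdd k * toHull hp (x + star b * b * x) := by
    rw [map_add, map_mul, ← one_add_mul, ← mul_assoc, invOneAdd_mul hk, one_mul]
  rw [← norm_toHull hp x, ← norm_toHull hp (x + _), h]
  exact (norm_mul_le _ _).trans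
    (mul_le_of_le_one_left (norm_nonneg _) (norm_invOneAdd_le hk))

/-- The exact solution `(1 + b* b)⁻¹ - 1` in the hull lies in the closure of the image of `A`;
approximate it there. -/
theorem IsCStarSeminorm.exists_quasiInverse_lt {p : A → ℝ} (hp : IsCStarSeminorm p) (b : A)
    {ε : ℝ} (hε : 0 < ε) : ∃ a, p (a + star b * b + star b * b * a) < ε := by
  have hk := toHull_star_mul_self_nonneg hp b
  set k := toHull hp (star b * b) with hk'
  have hmem := invOneAdd_sub_one_mem hk
    (NonUnitalStarSubalgebra.isClosed_topologicalClosure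
      (NonUnitalStarAlgHom.range (toHull hp)))
    (NonUnitalStarSubalgebra.le_topologicalClosure _ ⟨star b * b, rfl⟩)
  have hmem' : invOneAdd k - 1 ∈ closure (Set.range (toHull hp)) := hmem
  have hc : Continuous fun y : CStarHull hp => ‖y + k + k * y‖ := by fun_prop
  have hopen : IsOpen {y : CStarHull hp | ‖y + k + k * y‖ < ε} := isOpen_lt hc continuous_const
  obtain ⟨_, h1, ⟨a, rfl⟩⟩ := mem_closure_iff.1 hmem' _ hopen (by
    change ‖_‖ < ε
    rwa [invOneAdd_sub_one_add hk, norm_zero])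
  refine ⟨a, ?_⟩
  rw [← norm_toHull hp, map_add, map_add, map_mul _ _ a]
  exact h1

variable [TopologicalSpace A] [LocallyCStarAlgebra A]

theorem eq_zero_of_forall_seminorm_eq_zero {a : A} (h : ∀ p ∈ contSeminorms A, p a = 0) :
    a = 0 := by
  have h0 : (pure a : Filter A) ≤ 𝓝 0 := by
    rw [LocallyCStarAlgebra.le_nhds_zero_iff]
    intro p hp
    rw [tendsto_pure_left]
    intro s hs
    rw [h p hp]
    exact mem_of_mem_nhds hs
  by_contra hne
  exact h0 (isOpen_ne.mem_nhds (Ne.symm hne) : {x | x ≠ a} ∈ 𝓝 (0 : A)) rfl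

theorem exists_limit_of_cauchy (f : Filter A) (hf : f.NeBot)
    (h : ∀ p ∈ contSeminorms A, ∀ ε > 0, ∃ s ∈ f, ∀ x ∈ s, ∀ y ∈ s, p (x - y) < ε) :
    ∃ x, ∀ p ∈ contSeminorms A, Tendsto (fun y => p (y - x)) f (𝓝 0) := by
  have := (completeSpace_iff_of_le_nhds_zero_iff (X := A) (N := fun i : contSeminorms A => i.1)
    (fun i => i.2.1.nonneg) (fun l => by
      rw [LocallyCStarAlgebra.le_nhds_zero_iff, Subtype.forall])).1 LocallyCStarAlgebra.complete
    f hf (fun i => h i.1 i.2)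
  simpa only [Subtype.forall] using this

/-- The sets of approximate solutions for a seminorm and a tolerance generate a filter. It is proper
because seminorms have joins, and Cauchy because `le_add_mul` bounds the distance of two approximate
solutions by that of their defects. Its limit in `A` is an exact solution. -/
theorem exists_quasiInverse (b : A) : ∃ a, a + star b * b + star b * b * a = 0 := by
  set k := star b * b with hk
  let U : contSeminorms A × {ε : ℝ // 0 < ε} → Set A := fun i => {a | i.1.1 (a + k + k * a) < i.2.1}
  let f : Filter A := ⨅ i, 𝓟 (U i)
  have : Nonempty (contSeminorms A × {ε : ℝ // 0 < ε}) :=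
    ⟨⟨⟨_, zero_mem_contSeminorms⟩, 1, one_pos⟩⟩
  have hf : f.NeBot := by
    refine iInf_neBot_of_directed' ?_ fun i => ?_
    · rintro ⟨p, ε⟩ ⟨q, δ⟩
      refine ⟨⟨⟨_, sup_mem_contSeminorms p.2 q.2⟩, min ε.1 δ.1, lt_min ε.2 δ.2⟩, ?_, ?_⟩
      · refine principal_mono.2 fun a ha => ?_
        have h : max (p.1 (a + k + k * a)) (q.1 (a + k + k * a)) < min ε.1 δ.1 := ha
        have h' : p.1 (a + k + k * a) < ε.1 :=
          ((le_max_left _ _).trans_lt h).trans_le (min_le_left _ _)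
        exact h'
      · refine principal_mono.2 fun a ha => ?_
        have h : max (p.1 (a + k + k * a)) (q.1 (a + k + k * a)) < min ε.1 δ.1 := ha
        have h' : q.1 (a + k + k * a) < δ.1 :=
          ((le_max_right _ _).trans_lt h).trans_le (min_le_right _ _)
        exact h'
    · exact principal_neBot_iff.2 (i.1.2.1.exists_quasiInverse_lt b i.2.2)
  have hU : ∀ i, U i ∈ f := fun i => mem_iInf_of_mem i (mem_principal_self _)
  obtain ⟨a, ha⟩ := exists_limit_of_cauchy f hf fun p hp ε hε => by
    refine ⟨_, hU ⟨⟨p, hp⟩, ε / 2, half_pos hε⟩, fun x hx y hy => ?_⟩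
    refine (hp.1.le_add_mul b _).trans_lt ?_
    have h : x - y + star b * b * (x - y) = (x + k + k * x) - (y + k + k * y) := by
      rw [mul_sub, ← hk]
      abel
    rw [h]
    refine (hp.1.sub_le _ _).trans_lt ?_
    have hx' : p (x + k + k * x) < ε / 2 := hx
    have hy' : p (y + k + k * y) < ε / 2 := hy
    linarith
  refine ⟨a, eq_zero_of_forall_seminorm_eq_zero fun p hp => ?_⟩
  refine le_antisymm (le_of_forall_pos_le_add fun ε hε => ?_) (hp.1.nonneg _)
  have h1 : ∀ᶠ x in f, p (x + k + k * x) < ε / 2 := hU ⟨⟨p, hp⟩, ε / 2, half_pos hε⟩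
  have h2 : Tendsto (fun x => (1 + p k) * p (x - a)) f (𝓝 0) := by
    simpa using (ha p hp).const_mul (1 + p k)
  have h3 := h2.eventually_lt_const (half_pos hε)
  obtain ⟨x, hx1, hx2⟩ := (h1.and h3).exists
  have h : a + k + k * a = (x + k + k * x) - ((x - a) + k * (x - a)) := by
    rw [mul_sub]
    abel
  rw [h]
  have h4 := hp.1.sub_le (x + k + k * x) ((x - a) + k * (x - a))
  have h5 := hp.1.add_le (x - a) (k * (x - a))
  have h6 := hp.1.mul_le k (x - a)
  linarith

end QuasiInverse

/-! ### Cutoffs of vectors -/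

section Cutoff

variable {A : Type*} [NonUnitalRing A] [StarRing A] [Module ℂ A]
  [IsScalarTower ℂ A A] [SMulCommClass ℂ A A] [StarModule ℂ A]
  [TopologicalSpace A] [LocallyCStarAlgebra A]
  {E : Type*} [AddCommGroup E] [Module ℂ E] [InnerModule A E] [HilbertModule A E]

variable (E) in
theorem HilbertModule.isPositiveAt {p : A → ℝ} (hp : IsCStarSeminorm p) : IsPositiveAt E hp :=
  isPositiveAt_of_eq_star_mul_self hp HilbertModule.inn_self_nonneg

variable (A) in
/-- Every vector is the sum of `ξ a`, small wherever `ξ` is small, and a vector which is small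
for all seminorms simultaneously. -/
theorem exists_cutoff (ξ : E) {ε : ℝ} (hε : 0 < ε) :
    ∃ a : A, ∀ q ∈ contSeminorms A, q a ≤ 1 ∧
      vecSeminorm q (ξ + InnerModule.act ξ a) ≤ ε / 2 ∧
      (vecSeminorm q ξ ≤ ε → vecSeminorm q (InnerModule.act ξ a) ≤ ε / 2) := by
  obtain ⟨b, hb⟩ := HilbertModule.inn_self_nonneg (A := A) ξ
  -- In every hull `a` becomes `(1 + k)⁻¹ - 1` with `k = ⟨ξ, ξ⟩ / ε²`. Hence `ξ + ξ a` has inner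
  -- square `ε² (1 + k)⁻¹ k (1 + k)⁻¹`, of norm at most `(ε / 2)²`. The same `a` serves all
  -- seminorms.
  obtain ⟨a, ha⟩ := exists_quasiInverse ((ε⁻¹ : ℂ) • b)
  refine ⟨a, fun q hq => ?_⟩
  set π := toHull hq.1 with hπ
  have hk := toHull_star_mul_self_nonneg hq.1 ((ε⁻¹ : ℂ) • b)
  set k := π (star ((ε⁻¹ : ℂ) • b) * ((ε⁻¹ : ℂ) • b)) with hk'
  have hinn : π (InnerModule.inn ξ ξ) = ε ^ 2 • k := by
    have h1 : (InnerModule.inn ξ ξ : A) =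
        (ε ^ 2 : ℂ) • (star ((ε⁻¹ : ℂ) • b) * ((ε⁻¹ : ℂ) • b)) := by
      have h2 : star (ε⁻¹ : ℂ) = (ε⁻¹ : ℂ) := by
        rw [← Complex.ofReal_inv]
        exact Complex.conj_ofReal _
      have h3 : (ε : ℂ) ≠ 0 := by exact_mod_cast hε.ne'
      rw [star_smul, h2, smul_mul_smul_comm, smul_smul, hb]
      have h4 : (ε : ℂ) ^ 2 * ((ε : ℂ)⁻¹ * (ε : ℂ)⁻¹) = 1 := by field_simp
      rw [h4, one_smul]
    rw [h1, map_smul, ← Complex.coe_smul]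
    push_cast
    rfl
  have hπa : π a = invOneAdd k - 1 := by
    refine eq_invOneAdd_sub_one hk ?_
    rw [hk', ← map_mul, ← map_add, ← map_add, ha, map_zero]
  have hG : star (invOneAdd k) = invOneAdd k := isSelfAdjoint_invOneAdd hk
  have hε2 : (ε ^ 2 * (1 / 4) : ℝ) = (ε / 2) ^ 2 := by ring
  have hn2 : ‖ε ^ 2‖ = ε ^ 2 := Real.norm_of_nonneg (by positivity)
  refine ⟨?_, ?_, fun hξ => ?_⟩
  · rw [← norm_toHull hq.1, ← hπ, hπa]
    exact norm_invOneAdd_sub_one_le hk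
  · refine Real.sqrt_le_iff.2 ⟨by positivity, ?_⟩
    have h1 : π (InnerModule.inn (ξ + InnerModule.act ξ a) (ξ + InnerModule.act ξ a)) =
        ε ^ 2 • (invOneAdd k * k * invOneAdd k) := by
      simp only [add_inn, InnerModule.inn_add, act_inn, InnerModule.inn_act, map_add, map_mul,
        map_star, hπa, hinn, star_sub, star_one, hG, smul_mul_assoc, mul_smul_comm, ← smul_add]
      congr 1
      noncomm_ring
    rw [← norm_toHull hq.1, ← hπ, h1, norm_smul, hn2, ← hε2]
    exact mul_le_mul_of_nonneg_left (norm_invOneAdd_conj_le hk) (by positivity)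
  · refine Real.sqrt_le_iff.2 ⟨by positivity, ?_⟩
    have h1 : π (InnerModule.inn (InnerModule.act ξ a) (InnerModule.act ξ a)) =
        ε ^ 2 • ((invOneAdd k - 1) * k * (invOneAdd k - 1)) := by
      simp only [act_inn, InnerModule.inn_act, map_mul, map_star, hπa, hinn, star_sub, star_one,
        hG, smul_mul_assoc, mul_smul_comm, mul_assoc]
    have hk1 : ‖k‖ ≤ 1 := by
      have h2 : vecSeminorm q ξ ^ 2 ≤ ε ^ 2 :=
        pow_le_pow_left₀ (vecSeminorm_nonneg _ _) hξ 2
      rw [vecSeminorm_sq hq.1, ← norm_toHull hq.1, ← hπ, hinn, norm_smul, hn2] at h2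
      exact le_of_mul_le_mul_left (by simpa using h2) (by positivity : 0 < ε ^ 2)
    rw [← norm_toHull hq.1, ← hπ, h1, norm_smul, hn2, ← hε2]
    exact mul_le_mul_of_nonneg_left (norm_invOneAdd_sub_one_conj_le hk hk1) (by positivity)

end Cutoff

/-! ### Automatic boundedness of adjointable operators -/

section UniformBoundedness

variable {A : Type*} [NonUnitalRing A] [StarRing A] [Module ℂ A]
  [IsScalarTower ℂ A A] [SMulCommClass ℂ A A] [StarModule ℂ A]
  [TopologicalSpace A] [LocallyCStarAlgebra A]
  {E : Type*} [AddCommGroup E] [Module ℂ E] [InnerModule A E] [HilbertModule A E]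
  {F : Type*} [AddCommGroup F] [Module ℂ F] [InnerModule A F] [HilbertModule A F]

variable (A) in
-- The factor `3 / 2` is the sum of the powers of `1 / 3`.
theorem exists_limit_of_geometric (x : ℕ → E)
    (h : ∀ q ∈ contSeminorms A, ∀ n, vecSeminorm q (x (n + 1) - x n) ≤ (1 / 3) ^ n) :
    ∃ y : E, ∀ q ∈ contSeminorms A, ∀ n, vecSeminorm q (y - x n) ≤ 3 / 2 * (1 / 3) ^ n := by
  have htel : ∀ q ∈ contSeminorms A, ∀ n k,
      vecSeminorm q (x (n + k) - x n) ≤ 3 / 2 * ((1 / 3) ^ n - (1 / 3) ^ (n + k)) := by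
    intro q hq n k
    induction k with
    | zero => simp [vecSeminorm_zero hq.1]
    | succ k ih =>
      have h1 := (HilbertModule.isPositiveAt E hq.1).sub_le_sub_add_sub (x (n + (k + 1)))
        (x (n + k)) (x n)
      have h2 := h q hq (n + k)
      rw [← add_assoc] at h1 ⊢
      have h3 : ((1 : ℝ) / 3) ^ (n + k + 1) = (1 / 3) ^ (n + k) * (1 / 3) := pow_succ _ _
      linarith
  have htel' : ∀ q ∈ contSeminorms A, ∀ n m, n ≤ m →
      vecSeminorm q (x m - x n) ≤ 3 / 2 * (1 / 3) ^ n := by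
    intro q hq n m hnm
    obtain ⟨k, rfl⟩ := Nat.exists_eq_add_of_le hnm
    have h1 := htel q hq n k
    have h2 : (0 : ℝ) ≤ (1 / 3) ^ (n + k) := by positivity
    linarith
  have hpow : Tendsto (fun n : ℕ => (3 / 2 * (1 / 3 : ℝ) ^ n)) atTop (𝓝 0) := by
    have := (tendsto_pow_atTop_nhds_zero_of_lt_one (by norm_num : (0 : ℝ) ≤ 1 / 3)
      (by norm_num)).const_mul (3 / 2)
    rwa [mul_zero] at this
  obtain ⟨y, hy⟩ := HilbertModule.complete (A := A) (map x atTop) inferInstance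
    fun q hq ε hε => by
      obtain ⟨N, hN⟩ := (hpow.eventually_lt_const (half_pos hε)).exists
      refine ⟨x '' Set.Ici N, image_mem_map (Ici_mem_atTop N), ?_⟩
      rintro _ ⟨n, hn, rfl⟩ _ ⟨m, hm, rfl⟩
      have h1 := (HilbertModule.isPositiveAt E hq.1).sub_le_sub_add_sub (x n) (x N) (x m)
      rw [vecSeminorm_sub_rev hq.1 (x N)] at h1
      have h2 := htel' q hq N n hn
      have h3 := htel' q hq N m hm
      linarith
  refine ⟨y, fun q hq n => ?_⟩
  have hy' : Tendsto (fun m => vecSeminorm q (x m - y)) atTop (𝓝 0) := hy q hq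
  refine le_of_forall_pos_le_add fun ε hε => ?_
  obtain ⟨m, hm1, hm2⟩ := ((hy'.eventually_lt_const hε).and (eventually_ge_atTop n)).exists
  have h1 := (HilbertModule.isPositiveAt E hq.1).sub_le_sub_add_sub y (x m) (x n)
  rw [vecSeminorm_sub_rev hq.1 y (x m)] at h1
  have h2 := htel' q hq n m hm2
  linarith

/-- Choose `x` with `g x` above two thirds of the supremum, which is itself at least `c`. -/
theorem exists_almost_maximal {X : Type*} {S : Set X} {g : X → ℝ} {C c : ℝ}
    (hC : ∀ x ∈ S, g x ≤ C) (hc : 0 < c) {x₀ : X} (hx₀ : x₀ ∈ S) (h : c ≤ g x₀) :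
    ∃ x ∈ S, 2 / 3 * c ≤ g x ∧ ∀ y ∈ S, g y ≤ 3 / 2 * g x := by
  have hbdd : BddAbove (g '' S) := ⟨C, by rintro _ ⟨x, hx, rfl⟩; exact hC x hx⟩
  have h1 : c ≤ sSup (g '' S) := h.trans (le_csSup hbdd ⟨x₀, hx₀, rfl⟩)
  obtain ⟨_, ⟨x, hx, rfl⟩, hlt⟩ := exists_lt_of_lt_csSup (s := g '' S) ⟨_, x₀, hx₀, rfl⟩
    (show 2 / 3 * sSup (g '' S) < sSup (g '' S) by linarith)
  refine ⟨x, hx, by linarith, fun y hy => ?_⟩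
  have := le_csSup hbdd ⟨y, hy, rfl⟩
  linarith

variable (A E) in
/-- The vectors whose seminorms are all bounded by `1`. -/
def uniformUnitBall : Set E := {ξ | ∀ q ∈ contSeminorms A, vecSeminorm q ξ ≤ 1}

/-- A gliding hump. If `T` were unbounded on the ball, there would be `η n` of seminorm at most `1`
for which `G n = p ⟨T* (η n), ·⟩` exceeds `2/3 · 4ⁿ` at an almost maximal point `ξ n`; the supremum
of `G n` is finite by Cauchy–Schwarz. Steps `± 3⁻ⁿ ξ n` lead to a limit `y` with `G n y` at least of
order `(4/3)ⁿ`, although `G n y ≤ p (T y)`, the vector seminorm of `T y`. -/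
theorem Adjointable.exists_bound_uniformUnitBall (T : Adjointable A E F) {p : A → ℝ}
    (hp : p ∈ contSeminorms A) :
    ∃ C, ∀ ξ ∈ uniformUnitBall A E, vecSeminorm p (T ξ) ≤ C := by
  by_contra! hcon
  have hE := HilbertModule.isPositiveAt E hp.1
  have hF := HilbertModule.isPositiveAt F hp.1
  have hchoose : ∀ n : ℕ, ∃ (η : F) (ξ : E), ξ ∈ uniformUnitBall A E ∧ vecSeminorm p η ≤ 1 ∧
      2 / 3 * 4 ^ n ≤ p (InnerModule.inn (T.adj η) ξ) ∧
      ∀ ζ ∈ uniformUnitBall A E, p (InnerModule.inn (T.adj η) ζ) ≤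
        3 / 2 * p (InnerModule.inn (T.adj η) ξ) := by
    intro n
    obtain ⟨ξ₀, hξ₀, hlt⟩ := hcon (4 ^ n)
    set c := vecSeminorm p (T ξ₀) with hc
    have hc0 : 0 < c := lt_trans (by positivity) hlt
    set η : F := ((c⁻¹ : ℝ) : ℂ) • T ξ₀ with hη
    have hη1 : vecSeminorm p η = 1 := by
      rw [hη, vecSeminorm_smul hp.1, Complex.norm_real, Real.norm_of_nonneg (by positivity), ← hc,
        inv_mul_cancel₀ hc0.ne']
    have hg : p (InnerModule.inn (T.adj η) ξ₀) = c := by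
      rw [Adjointable.adj_inn, hη, smul_inn, hp.1.smul_eq, norm_star, Complex.norm_real,
        Real.norm_of_nonneg (by positivity), ← vecSeminorm_sq hp.1, ← hc]
      field_simp
    obtain ⟨ξ, hξ, h1, h2⟩ := exists_almost_maximal
      (g := fun ζ => p (InnerModule.inn (T.adj η) ζ)) (C := vecSeminorm p (T.adj η))
      (S := uniformUnitBall A E) (c := 4 ^ n)
      (fun ζ hζ => (hE.inn_le _ _).trans
        (mul_le_of_le_one_right (vecSeminorm_nonneg _ _) (hζ p hp)))
      (by positivity) hξ₀ (by rw [hg]; exact hlt.le)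
    exact ⟨η, ξ, hξ, hη1.le, h1, h2⟩
  choose η ξ hξ hη hlarge hmax using hchoose
  set G : ℕ → E → ℝ := fun n ζ => p (InnerModule.inn (T.adj (η n)) ζ) with hG
  have hGsub : ∀ n ζ ζ', G n (ζ - ζ') ≤ G n ζ + G n ζ' := fun n ζ ζ' => by
    rw [hG]
    beta_reduce
    rw [inn_sub]
    exact hp.1.sub_le _ _
  have hGsmul : ∀ n (t : ℝ) ζ, 0 ≤ t → G n ((t : ℂ) • ζ) = t * G n ζ := fun n t ζ ht => by
    rw [hG]
    beta_reduce
    rw [InnerModule.inn_smul, hp.1.smul_eq, Complex.norm_real, Real.norm_of_nonneg ht]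
  have hstep : ∀ n (x : E), ∃ y : E, (∀ q ∈ contSeminorms A, vecSeminorm q (y - x) ≤ (1 / 3) ^ n) ∧
      (1 / 3) ^ n * G n (ξ n) ≤ G n y := by
    intro n x
    set v : E := (((1 / 3) ^ n : ℝ) : ℂ) • ξ n with hv
    have hv1 : ∀ q ∈ contSeminorms A, vecSeminorm q v ≤ (1 / 3) ^ n := fun q hq => by
      rw [hv, vecSeminorm_smul hq.1, Complex.norm_real, Real.norm_of_nonneg (by positivity)]
      exact mul_le_of_le_one_right (by positivity) (hξ n q hq)
    have hv2 : G n v = (1 / 3) ^ n * G n (ξ n) := hGsmul n _ _ (by positivity)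
    -- As `2v = (x + v) - (x - v)`, at least one of `G n (x + v)` and `G n (x - v)` is no smaller
    -- than `G n v`.
    rcases le_total ((1 / 3) ^ n * G n (ξ n)) (G n (x + v)) with h | h
    · exact ⟨x + v, fun q hq => by rw [add_sub_cancel_left]; exact hv1 q hq, h⟩
    · refine ⟨x - v, fun q hq => by
        rw [sub_sub_cancel_left, vecSeminorm_neg hq.1]; exact hv1 q hq, ?_⟩
      have h1 := hGsub n (x + v) (x - v)
      have h2 : (x + v) - (x - v) = ((2 : ℝ) : ℂ) • v := by
        push_cast
        module
      rw [h2, hGsmul n 2 v (by norm_num), hv2] at h1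
      linarith
  choose next hnext1 hnext2 using hstep
  let x : ℕ → E := fun n => Nat.rec 0 next n
  obtain ⟨y, hy⟩ := exists_limit_of_geometric A x fun q hq n => hnext1 n (x n) q hq
  have hfinal : ∀ n : ℕ, (4 / 3 : ℝ) ^ n ≤ 18 * vecSeminorm p (T y) := by
    intro n
    have h1 : (1 / 3) ^ n * G n (ξ n) ≤ G n (x (n + 1)) := hnext2 n (x n)
    have h2 : G n (x (n + 1)) ≤ G n y + G n (y - x (n + 1)) := by
      have := hGsub n y (y - x (n + 1))
      rwa [sub_sub_cancel] at this
    -- The tail after step `n` is at most `3/2 · 3⁻⁽ⁿ⁺¹⁾ = 1/2 · 3⁻ⁿ` in all seminorms, so almost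
    -- maximality of `ξ n` applies to it. The loss is `3/4` of the gain `3⁻ⁿ G n (ξ n)`, and a
    -- quarter survives.
    have h3 : G n (y - x (n + 1)) ≤ 1 / 2 * (1 / 3) ^ n * (3 / 2 * G n (ξ n)) := by
      set t : ℝ := 1 / 2 * (1 / 3) ^ n with ht
      have ht0 : 0 < t := by positivity
      have hmem : ((t⁻¹ : ℝ) : ℂ) • (y - x (n + 1)) ∈ uniformUnitBall A E := fun q hq => by
        rw [vecSeminorm_smul hq.1, Complex.norm_real, Real.norm_of_nonneg (by positivity)]
        refine (mul_le_mul_of_nonneg_left (hy q hq (n + 1)) (by positivity)).trans (le_of_eq ?_)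
        rw [show (3 / 2 * (1 / 3) ^ (n + 1) : ℝ) = t by rw [ht, pow_succ]; ring,
          inv_mul_cancel₀ ht0.ne']
      have h4 := hmax n _ hmem
      have h5 : G n (((t⁻¹ : ℝ) : ℂ) • (y - x (n + 1))) = t⁻¹ * G n (y - x (n + 1)) :=
        hGsmul n _ _ (by positivity)
      have h6 : t⁻¹ * G n (y - x (n + 1)) ≤ 3 / 2 * G n (ξ n) := by
        rw [← h5]
        exact h4
      rwa [inv_mul_le_iff₀ ht0] at h6
    have h4 : G n y ≤ vecSeminorm p (T y) := by
      rw [hG]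
      beta_reduce
      rw [Adjointable.adj_inn]
      exact (hF.inn_le _ _).trans (mul_le_of_le_one_left (vecSeminorm_nonneg _ _) (hη n))
    have h5 : (1 / 3) ^ n * (2 / 3 * 4 ^ n) ≤ (1 / 3) ^ n * G n (ξ n) :=
      mul_le_mul_of_nonneg_left (hlarge n) (by positivity)
    have h6 : ((1 : ℝ) / 3) ^ n * (2 / 3 * 4 ^ n) = 2 / 3 * (4 / 3) ^ n := by
      rw [show (4 / 3 : ℝ) = 1 / 3 * 4 by norm_num, mul_pow]
      ring
    have h7 : (0 : ℝ) < (4 / 3) ^ n := by positivity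
    linarith
  obtain ⟨n, hn⟩ := pow_unbounded_of_one_lt (18 * vecSeminorm p (T y))
    (by norm_num : (1 : ℝ) < 4 / 3)
  exact absurd (hfinal n) (not_le.2 hn)

/-- Adjointable operators between Hilbert modules are bounded for each continuous
`C*`-seminorm. -/
theorem Adjointable.exists_bound (T : Adjointable A E F) {p : A → ℝ}
    (hp : p ∈ contSeminorms A) : ∃ C, 0 ≤ C ∧ ∀ ξ, vecSeminorm p (T ξ) ≤ C * vecSeminorm p ξ := by
  obtain ⟨C, hC⟩ := T.exists_bound_uniformUnitBall hp
  have hE := HilbertModule.isPositiveAt E hp.1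
  have hF := HilbertModule.isPositiveAt F hp.1
  have hC0 : 0 ≤ C := (vecSeminorm_nonneg p (T 0)).trans (hC 0 fun q hq => by
    rw [vecSeminorm_zero hq.1]; exact zero_le_one)
  have hC' : ∀ (ξ : E) (r : ℝ), 0 < r → (∀ q ∈ contSeminorms A, vecSeminorm q ξ ≤ r) →
      vecSeminorm p (T ξ) ≤ C * r := by
    intro ξ r hr hξ
    have h1 := hC (((r⁻¹ : ℝ) : ℂ) • ξ) fun q hq => by
      rw [vecSeminorm_smul hq.1, Complex.norm_real, Real.norm_of_nonneg (by positivity),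
        inv_mul_le_iff₀ hr, mul_one]
      exact hξ q hq
    rw [Adjointable.map_smul, vecSeminorm_smul hp.1, Complex.norm_real,
      Real.norm_of_nonneg (by positivity), inv_mul_le_iff₀ hr] at h1
    linarith
  -- Start from Cauchy–Schwarz with `T* η`. In each step write `ξ = (ξ + ξ a) - ξ a`: the first
  -- vector is at most `r / 2` in all seminorms and is covered by `hC'`, the second is at most `r /
  -- 2` for `p` and is covered by induction. The crude term is halved each time, while the main
  -- terms again add up to `C r`.
  have hiter : ∀ (η : F) (n : ℕ) (ξ : E) (r : ℝ), 0 < r → vecSeminorm p ξ ≤ r →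
      p (InnerModule.inn η (T ξ)) ≤
        vecSeminorm p η * C * r + vecSeminorm p (T.adj η) * r * (1 / 2) ^ n := by
    intro η n
    have hη := vecSeminorm_nonneg p η
    induction n with
    | zero =>
      intro ξ r hr hξ
      rw [← Adjointable.adj_inn]
      have h1 := hE.inn_le (T.adj η) ξ
      have h2 := mul_le_mul_of_nonneg_left hξ (vecSeminorm_nonneg p (T.adj η))
      have h3 : 0 ≤ vecSeminorm p η * C * r := by positivity
      rw [pow_zero, mul_one]
      linarith
    | succ n ih =>
      intro ξ r hr hξ
      obtain ⟨a, ha⟩ := exists_cutoff A ξ hr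
      have h1 := ih _ (r / 2) (half_pos hr) ((ha p hp).2.2 hξ)
      have h2 := (hF.inn_le η (T (ξ + InnerModule.act ξ a))).trans
        (mul_le_mul_of_nonneg_left (hC' _ (r / 2) (half_pos hr) fun q hq => (ha q hq).2.1) hη)
      have h3 : (InnerModule.inn η (T ξ) : A) =
          InnerModule.inn η (T (ξ + InnerModule.act ξ a)) -
            InnerModule.inn η (T (InnerModule.act ξ a)) := by
        rw [Adjointable.map_add, InnerModule.inn_add, add_sub_cancel_right]
      rw [h3]
      refine (hp.1.sub_le _ _).trans ?_
      rw [pow_succ]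
      linarith
  have hinn : ∀ (η : F) (ξ : E) (r : ℝ), 0 < r → vecSeminorm p ξ ≤ r →
      p (InnerModule.inn η (T ξ)) ≤ vecSeminorm p η * C * r := by
    intro η ξ r hr hξ
    have hlim : Tendsto (fun n : ℕ => vecSeminorm p η * C * r +
        vecSeminorm p (T.adj η) * r * (1 / 2) ^ n) atTop (𝓝 (vecSeminorm p η * C * r)) := by
      have := ((tendsto_pow_atTop_nhds_zero_of_lt_one (by norm_num : (0 : ℝ) ≤ 1 / 2)
        (by norm_num)).const_mul (vecSeminorm p (T.adj η) * r)).const_add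
          (vecSeminorm p η * C * r)
      rwa [mul_zero, add_zero] at this
    exact ge_of_tendsto' hlim fun n => hiter η n ξ r hr hξ
  -- Take `η = T ξ` in `hinn` and cancel one factor.
  refine ⟨C, hC0, fun ξ => ?_⟩
  rw [mul_comm]
  refine le_mul_of_forall_pos_le hC0 fun ε hε => ?_
  have h1 := hinn (T ξ) ξ (vecSeminorm p ξ + ε)
    (add_pos_of_nonneg_of_pos (vecSeminorm_nonneg _ _) hε) (by linarith)
  rw [← vecSeminorm_sq hp.1, sq, mul_assoc] at h1
  rcases (vecSeminorm_nonneg p (T ξ)).eq_or_lt with h | h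
  · rw [← h]
    have := vecSeminorm_nonneg p ξ
    positivity
  · rw [mul_comm (vecSeminorm p ξ + ε)]
    exact le_of_mul_le_mul_left h1 h

end UniformBoundedness

/-! ### Operator seminorms: `C*`-identity and monotonicity -/

section OperatorSeminorm

variable {A : Type*} [NonUnitalRing A] [StarRing A] [Module ℂ A]
  [IsScalarTower ℂ A A] [SMulCommClass ℂ A A] [StarModule ℂ A]
  {E : Type*} [AddCommGroup E] [Module ℂ E] [InnerModule A E]
  {F : Type*} [AddCommGroup F] [Module ℂ F] [InnerModule A F]
  {G : Type*} [AddCommGroup G] [Module ℂ G] [InnerModule A G]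
  {p q : A → ℝ}

namespace Adjointable

/-- `T` is bounded for the seminorms associated with `p`. -/
def IsBoundedAt (p : A → ℝ) (T : Adjointable A E F) : Prop :=
  ∃ C, ∀ ξ, vecSeminorm p (T ξ) ≤ C * vecSeminorm p ξ

theorem opSeminorm_nonneg (p : A → ℝ) (T : Adjointable A E F) : 0 ≤ T.opSeminorm p :=
  Real.sSup_nonneg (by rintro _ ⟨ξ, -, rfl⟩; exact vecSeminorm_nonneg _ _)

theorem opSeminorm_le (T : Adjointable A E F) {C : ℝ} (hC : 0 ≤ C)
    (h : ∀ ξ, vecSeminorm p (T ξ) ≤ C * vecSeminorm p ξ) : T.opSeminorm p ≤ C := by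
  refine Real.sSup_le ?_ hC
  rintro _ ⟨ξ, hξ, rfl⟩
  exact (h ξ).trans (mul_le_of_le_one_right hC hξ)

variable (hp : IsCStarSeminorm p)
include hp

theorem le_opSeminorm {T : Adjointable A E F} (hT : T.IsBoundedAt p) (ξ : E) :
    vecSeminorm p (T ξ) ≤ T.opSeminorm p * vecSeminorm p ξ := by
  obtain ⟨C, hC⟩ := hT
  rcases (vecSeminorm_nonneg p ξ).eq_or_lt with h | h
  · have := hC ξ
    rwa [← h, mul_zero] at this ⊢
  · set c := vecSeminorm p ξ with hc
    have hbdd : BddAbove ((fun ξ : E => vecSeminorm p (T ξ)) '' {ξ : E | vecSeminorm p ξ ≤ 1}) := by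
      refine ⟨|C|, ?_⟩
      rintro _ ⟨ζ, hζ, rfl⟩
      have h1 := hC ζ
      have hζ' : vecSeminorm p ζ ≤ 1 := hζ
      have h2 := mul_le_mul_of_nonneg_right (le_abs_self C) (vecSeminorm_nonneg p ζ)
      exact (h1.trans h2).trans (mul_le_of_le_one_right (abs_nonneg C) hζ')
    have h1 : vecSeminorm p (T (((c⁻¹ : ℝ) : ℂ) • ξ)) ≤ T.opSeminorm p := by
      refine le_csSup hbdd ⟨_, ?_, rfl⟩
      change vecSeminorm p _ ≤ 1
      rw [vecSeminorm_smul hp, Complex.norm_real, Real.norm_of_nonneg (by positivity), ← hc,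
        inv_mul_cancel₀ h.ne']
    rw [map_smul, vecSeminorm_smul hp, Complex.norm_real, Real.norm_of_nonneg (by positivity),
      inv_mul_le_iff₀ h, mul_comm] at h1
    exact h1

theorem isBoundedAt_comp {S : Adjointable A F G} {T : Adjointable A E F} (hS : S.IsBoundedAt p)
    (hT : T.IsBoundedAt p) : (S.comp T).IsBoundedAt p :=
  ⟨S.opSeminorm p * T.opSeminorm p, fun ξ => by
    rw [mul_assoc]
    exact (le_opSeminorm hp hS (T ξ)).trans
      (mul_le_mul_of_nonneg_left (le_opSeminorm hp hT ξ) (opSeminorm_nonneg _ _))⟩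

theorem opSeminorm_comp_le {S : Adjointable A F G} {T : Adjointable A E F}
    (hS : S.IsBoundedAt p) (hT : T.IsBoundedAt p) :
    (S.comp T).opSeminorm p ≤ S.opSeminorm p * T.opSeminorm p := by
  refine opSeminorm_le _ (mul_nonneg (opSeminorm_nonneg _ _) (opSeminorm_nonneg _ _)) fun ξ => ?_
  rw [mul_assoc]
  exact (le_opSeminorm hp hS (T ξ)).trans
    (mul_le_mul_of_nonneg_left (le_opSeminorm hp hT ξ) (opSeminorm_nonneg _ _))

theorem opSeminorm_smul_le (c : ℂ) {T : Adjointable A E F} (hT : T.IsBoundedAt p) :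
    (c • T).opSeminorm p ≤ ‖c‖ * T.opSeminorm p := by
  refine opSeminorm_le _ (mul_nonneg (norm_nonneg _) (opSeminorm_nonneg _ _)) fun ξ => ?_
  rw [smul_apply, vecSeminorm_smul hp, mul_assoc]
  exact mul_le_mul_of_nonneg_left (le_opSeminorm hp hT ξ) (norm_nonneg _)

variable {hp} (hE : IsPositiveAt E hp) (hF : IsPositiveAt F hp)
include hF

theorem opSeminorm_add_le {S T : Adjointable A E F} (hS : S.IsBoundedAt p)
    (hT : T.IsBoundedAt p) : (S + T).opSeminorm p ≤ S.opSeminorm p + T.opSeminorm p := by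
  refine opSeminorm_le _ (add_nonneg (opSeminorm_nonneg _ _) (opSeminorm_nonneg _ _)) fun ξ => ?_
  rw [add_apply, add_mul]
  exact (hF.add_le _ _).trans (add_le_add (le_opSeminorm hp hS ξ) (le_opSeminorm hp hT ξ))

/-- Apply Cauchy–Schwarz to `⟨T* η, T* η⟩ = ⟨η, T T* η⟩` and cancel one factor. -/
theorem adj_le_of_le {T : Adjointable A E F} {C : ℝ} (hC : 0 ≤ C)
    (h : ∀ ξ, vecSeminorm p (T ξ) ≤ C * vecSeminorm p ξ) (η : F) :
    vecSeminorm p (T.adj η) ≤ C * vecSeminorm p η := by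
  have h1 : vecSeminorm p (T.adj η) ^ 2 ≤ vecSeminorm p η * (C * vecSeminorm p (T.adj η)) := by
    rw [vecSeminorm_sq hp, adj_inn]
    exact (hF.inn_le _ _).trans (mul_le_mul_of_nonneg_left (h _) (vecSeminorm_nonneg _ _))
  have h2 := vecSeminorm_nonneg p η
  rcases (vecSeminorm_nonneg p (T.adj η)).eq_or_lt with h0 | h0
  · rw [← h0]
    positivity
  · refine le_of_mul_le_mul_right (h1.trans (le_of_eq ?_) |>.trans' (sq _).symm.le) h0
    ring

include hE

theorem opSeminorm_adj {T : Adjointable A E F} (hT : T.IsBoundedAt p) :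
    T.adj.opSeminorm p = T.opSeminorm p := by
  have h1 : ∀ η, vecSeminorm p (T.adj η) ≤ T.opSeminorm p * vecSeminorm p η :=
    adj_le_of_le hF (opSeminorm_nonneg _ _) (le_opSeminorm hp hT)
  refine le_antisymm (opSeminorm_le _ (opSeminorm_nonneg _ _) h1)
    (opSeminorm_le _ (opSeminorm_nonneg _ _) fun ξ => ?_)
  have h2 := adj_le_of_le hE (opSeminorm_nonneg p T.adj) (le_opSeminorm hp ⟨_, h1⟩) ξ
  rwa [adj_adj] at h2

theorem isBoundedAt_adj {T : Adjointable A E F} (hT : T.IsBoundedAt p) : T.adj.IsBoundedAt p :=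
  ⟨_, adj_le_of_le hF (opSeminorm_nonneg p T) (le_opSeminorm hp hT)⟩

theorem opSeminorm_adj_comp {T : Adjointable A E F} (hT : T.IsBoundedAt p) :
    (T.adj.comp T).opSeminorm p = T.opSeminorm p ^ 2 := by
  have hT' := isBoundedAt_adj hE hF hT
  refine le_antisymm ?_ ?_
  · refine (opSeminorm_comp_le hp hT' hT).trans (le_of_eq ?_)
    rw [opSeminorm_adj hE hF hT, sq]
  · have h1 : T.opSeminorm p ≤ √((T.adj.comp T).opSeminorm p) := by
      refine opSeminorm_le _ (Real.sqrt_nonneg _) fun ξ => ?_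
      refine le_of_sq_le_sq ?_ (mul_nonneg (Real.sqrt_nonneg _) (vecSeminorm_nonneg _ _))
      rw [mul_pow, Real.sq_sqrt (opSeminorm_nonneg _ _), vecSeminorm_sq hp, inn_adj]
      refine (hE.inn_le _ _).trans ?_
      have h2 := le_opSeminorm hp (isBoundedAt_comp hp hT' hT) ξ
      have h3 := mul_le_mul_of_nonneg_left h2 (vecSeminorm_nonneg p ξ)
      refine h3.trans (le_of_eq ?_)
      ring
    calc T.opSeminorm p ^ 2 ≤ √((T.adj.comp T).opSeminorm p) ^ 2 :=
          pow_le_pow_left₀ (opSeminorm_nonneg _ _) h1 2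
      _ = _ := Real.sq_sqrt (opSeminorm_nonneg _ _)

/-- If `T` is `p`-bounded, the inner products `⟨ξ, (T* T)ⁿ ξ⟩` grow at most geometrically. -/
theorem inn_pow_le {T : Adjointable A E F} (hT : T.IsBoundedAt p) (ξ : E) (n : ℕ) :
    p (InnerModule.inn ξ (((T.adj.comp T) ^ n) ξ)) ≤
      vecSeminorm p ξ ^ 2 * (T.opSeminorm p ^ 2) ^ n := by
  have hD : (T.adj.comp T).IsBoundedAt p := isBoundedAt_comp hp (isBoundedAt_adj hE hF hT) hT
  have h0 : 0 ≤ T.opSeminorm p ^ 2 := sq_nonneg _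
  have h1 : ∀ n, vecSeminorm p (((T.adj.comp T) ^ n) ξ) ≤
      (T.opSeminorm p ^ 2) ^ n * vecSeminorm p ξ := by
    intro n
    induction n with
    | zero => simp [one_apply]
    | succ n ih =>
      rw [pow_succ', mul_apply]
      refine (le_opSeminorm hp hD _).trans ?_
      rw [opSeminorm_adj_comp hE hF hT, pow_succ' (T.opSeminorm p ^ 2), mul_assoc]
      exact mul_le_mul_of_nonneg_left ih h0
  refine (hE.inn_le _ _).trans
    ((mul_le_mul_of_nonneg_left (h1 n) (vecSeminorm_nonneg _ _)).trans (le_of_eq ?_))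
  ring

/-- A bound for `T` with respect to `p` is also a bound with respect to each smaller
seminorm `q`. -/
theorem map_le_of_seminorm_le {hq : IsCStarSeminorm q} (hE' : IsPositiveAt E hq)
    (hF' : IsPositiveAt F hq) (hqp : ∀ a, q a ≤ p a) {T : Adjointable A E F}
    (hT : T.IsBoundedAt p) (ξ : E) :
    vecSeminorm q (T ξ) ≤ T.opSeminorm p * vecSeminorm q ξ := by
  -- Only the growth rate of the moments matters to `map_le`. The factor in front is the squared
  -- `p`-seminorm of `ξ`, which `q` need not control.
  have h := hE'.map_le hF' T ξ (sq_nonneg (T.opSeminorm p))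
    fun n => (hqp _).trans (inn_pow_le hE hF hT ξ n)
  rw [← mul_pow] at h
  exact le_of_sq_le_sq h (mul_nonneg (opSeminorm_nonneg _ _) (vecSeminorm_nonneg _ _))

theorem opSeminorm_mono {hq : IsCStarSeminorm q} (hE' : IsPositiveAt E hq)
    (hF' : IsPositiveAt F hq) (hqp : ∀ a, q a ≤ p a) {T : Adjointable A E F}
    (hT : T.IsBoundedAt p) : T.opSeminorm q ≤ T.opSeminorm p :=
  opSeminorm_le _ (opSeminorm_nonneg _ _) (map_le_of_seminorm_le hE hF hE' hF' hqp hT)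

end Adjointable

end OperatorSeminorm

/-! ### Topologies given by seminorms -/

section SeminormTopology

variable {X ι : Type*} [AddCommGroup X] [Module ℂ X]

/-- The functions `x ↦ N (x - x₀)` are the distances to the points `x₀`, and these determine a
pseudometric topology. -/
theorem iInf_induced_eq (N : Seminorm ℂ X) :
    (⨅ x₀ : X, TopologicalSpace.induced (fun x => N (x - x₀)) inferInstance) =
      N.toSeminormedAddCommGroup.toUniformSpace.toTopologicalSpace := by
  let _ := N.toSeminormedAddCommGroup
  refine le_antisymm (le_of_nhds_le_nhds fun x => ?_) (le_iInf fun x₀ => ?_)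
  · rw [nhds_iInf, ← nhds_comap_dist]
    refine (iInf_le _ x).trans ?_
    rw [nhds_induced, sub_self, map_zero]
    refine le_of_eq (congrArg (fun g => comap g (𝓝 (0 : ℝ))) (funext fun y => ?_))
    rw [dist_eq_norm]
    rfl
  · rw [← continuous_iff_le_induced]
    exact (continuous_norm (E := X)).comp (continuous_id.sub continuous_const)

theorem seminormTopology_range_eq (N : ι → Seminorm ℂ X) :
    seminormTopology (Set.range fun i => (N i : X → ℝ)) =
      ⨅ i, (N i).toSeminormedAddCommGroup.toUniformSpace.toTopologicalSpace := by
  simp only [seminormTopology, iInf_range, iInf_induced_eq]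

theorem withSeminorms_of_eq_seminormTopology [t : TopologicalSpace X] {N : SeminormFamily ℂ X ι}
    (h : t = seminormTopology (Set.range fun i => (N i : X → ℝ))) : WithSeminorms N := by
  rw [seminormTopology_range_eq] at h
  have : IsTopologicalAddGroup X := by
    rw [h]
    exact topologicalAddGroup_iInf fun i => by
      let _ := (N i).toSeminormedAddCommGroup
      infer_instance
  exact N.withSeminorms_iff_topologicalSpace_eq_iInf.2 h

variable [TopologicalSpace X] {N : SeminormFamily ℂ X ι} (hN : WithSeminorms N)
include hN

theorem le_nhds_zero_iff_of_withSeminorms (l : Filter X) :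
    l ≤ 𝓝 0 ↔ ∀ i, Tendsto (N i) l (𝓝 0) := by
  have := hN.topologicalAddGroup
  rw [N.withSeminorms_iff_nhds_eq_iInf.1 hN, le_iInf_iff]
  exact forall_congr' fun i => tendsto_iff_comap.symm

theorem t2Space_of_withSeminorms (hsep : ∀ x, (∀ i, N i x = 0) → x = 0) : T2Space X := by
  have := hN.topologicalAddGroup
  have := hN.T1_of_separating fun x hx => by
    by_contra! h
    exact hx (hsep x h)
  infer_instance

theorem completeSpace_of_withSeminorms [IsTopologicalAddGroup X]
    (hc : ∀ f : Filter X, f.NeBot →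
      (∀ i, ∀ ε > 0, ∃ s ∈ f, ∀ x ∈ s, ∀ y ∈ s, N i (x - y) < ε) →
      ∃ x, ∀ i, Tendsto (fun y => N i (y - x)) f (𝓝 0)) :
    @CompleteSpace X (IsTopologicalAddGroup.rightUniformSpace X) :=
  (completeSpace_iff_of_le_nhds_zero_iff (N := fun i x => N i x)
    (fun i x => apply_nonneg (N i) x) (le_nhds_zero_iff_of_withSeminorms hN)).2 hc

theorem completeLocallyConvex_of_withSeminorms (hsep : ∀ x, (∀ i, N i x = 0) → x = 0)
    (hc : ∀ f : Filter X, f.NeBot →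
      (∀ i, ∀ ε > 0, ∃ s ∈ f, ∀ x ∈ s, ∀ y ∈ s, N i (x - y) < ε) →
      ∃ x, ∀ i, Tendsto (fun y => N i (y - x)) f (𝓝 0)) : CompleteLocallyConvex X :=
  have := hN.topologicalAddGroup
  { hN.topologicalAddGroup, hN.continuousSMul, t2Space_of_withSeminorms hN hsep,
    hN.toLocallyConvexSpace with
    complete := completeSpace_of_withSeminorms hN hc }

end SeminormTopology

section LocallyCStarOfSeminorms

variable {X ι : Type*} [NonUnitalRing X] [StarRing X] [Module ℂ X] [IsScalarTower ℂ X X]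
  [SMulCommClass ℂ X X] [StarModule ℂ X] [TopologicalSpace X]
  {N : SeminormFamily ℂ X ι} (hN : WithSeminorms N) (hC : ∀ i, IsCStarSeminorm (N i))
include hN hC

/-- It is enough that some family of `C*`-seminorms generates the topology: each member is then
continuous and belongs to `contSeminorms X`. Joint continuity of the product comes from
submultiplicativity. -/
theorem locallyCStarAlgebra_of_withSeminorms (hsep : ∀ x, (∀ i, N i x = 0) → x = 0)
    (hc : ∀ f : Filter X, f.NeBot →
      (∀ i, ∀ ε > 0, ∃ s ∈ f, ∀ x ∈ s, ∀ y ∈ s, N i (x - y) < ε) →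
      ∃ x, ∀ i, Tendsto (fun y => N i (y - x)) f (𝓝 0)) : LocallyCStarAlgebra X := by
  have hgrp := hN.topologicalAddGroup
  have htendsto : ∀ {Y : Type _} (u : Y → X) (l : Filter Y) (x : X),
      Tendsto u l (𝓝 x) ↔ ∀ i, Tendsto (fun y => N i (u y - x)) l (𝓝 0) := by
    intro Y u l x
    rw [← tendsto_sub_nhds_zero_iff, Tendsto, le_nhds_zero_iff_of_withSeminorms hN]
    rfl
  have hmul : ContinuousMul X := by
    refine ⟨continuous_iff_continuousAt.2 ?_⟩
    rintro ⟨x, y⟩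
    rw [ContinuousAt, htendsto]
    intro i
    have hcont := hN.continuous_seminorm i
    have hbound : Continuous fun z : X × X =>
        N i (z.1 - x) * N i z.2 + N i x * N i (z.2 - y) := by fun_prop
    have h0 : Tendsto (fun z : X × X => N i (z.1 - x) * N i z.2 + N i x * N i (z.2 - y))
        (𝓝 (x, y)) (𝓝 0) := by
      have := hbound.tendsto (x, y)
      simpa using this
    refine squeeze_zero (fun z => apply_nonneg _ _) (fun z => ?_) h0
    have h1 : z.1 * z.2 - (x, y).1 * (x, y).2 = (z.1 - x) * z.2 + x * (z.2 - y) := by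
      rw [sub_mul, mul_sub]
      abel
    rw [h1]
    exact ((hC i).add_le _ _).trans (add_le_add ((hC i).mul_le _ _) ((hC i).mul_le _ _))
  have hstar : ContinuousStar X := by
    refine ⟨continuous_iff_continuousAt.2 fun x => ?_⟩
    rw [ContinuousAt, htendsto]
    intro i
    have hcont := hN.continuous_seminorm i
    have hbound : Continuous fun z : X => N i (z - x) := by fun_prop
    have h0 := hbound.tendsto x
    simp only [sub_self, map_zero] at h0
    refine h0.congr fun z => ?_
    rw [← star_sub, (hC i).map_star]
  have hring : IsTopologicalRing X := { hmul, hgrp with }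
  exact
    { hring, hN.continuousSMul, hstar, t2Space_of_withSeminorms hN hsep with
      le_nhds_zero_iff := fun l => by
        constructor
        · intro hl p hp
          have h0 := hp.2.tendsto 0
          rw [hp.1.map_zero] at h0
          exact h0.mono_left hl
        · intro h
          exact (le_nhds_zero_iff_of_withSeminorms hN l).2 fun i =>
            h _ ⟨hC i, hN.continuous_seminorm i⟩
      complete := completeSpace_of_withSeminorms hN hc }

end LocallyCStarOfSeminorms

/-! ### The spaces `L_A(E, F)` and algebras `L_A(E)` -/

section Operators

variable {A : Type*} [NonUnitalRing A] [StarRing A] [Module ℂ A]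
  [IsScalarTower ℂ A A] [SMulCommClass ℂ A A] [StarModule ℂ A]
  {E : Type*} [AddCommGroup E] [Module ℂ E] [InnerModule A E]
  {F : Type*} [AddCommGroup F] [Module ℂ F] [InnerModule A F]

namespace Adjointable

/-- Two maps which are adjoint to each other are adjointable operators. -/
def ofInner (T : E → F) (S : F → E)
    (h : ∀ ξ η, (InnerModule.inn (T ξ) η : A) = InnerModule.inn ξ (S η)) : Adjointable A E F :=
  have h' : ∀ ξ η, (InnerModule.inn η (T ξ) : A) = InnerModule.inn (S η) ξ := fun ξ η => by
    rw [← InnerModule.star_inn, h, InnerModule.star_inn]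
  ⟨{ toFun := T
     map_add' := fun ξ ζ => ext_inn A fun η => by
      rw [h', InnerModule.inn_add, InnerModule.inn_add, h', h']
     map_smul' := fun c ξ => ext_inn A fun η => by
      rw [h', InnerModule.inn_smul, RingHom.id_apply, InnerModule.inn_smul, h'] },
    fun ξ a => ext_inn A fun η => by
      change InnerModule.inn η (T _) = InnerModule.inn η (InnerModule.act (T ξ) a)
      rw [h', InnerModule.inn_act, InnerModule.inn_act, h'],
    { toFun := S
      map_add' := fun ξ ζ => ext_inn A fun η => by
        rw [← h, InnerModule.inn_add, InnerModule.inn_add, h, h]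
      map_smul' := fun c ξ => ext_inn A fun η => by
        rw [← h, InnerModule.inn_smul, RingHom.id_apply, InnerModule.inn_smul, h] },
    fun ξ a => ext_inn A fun η => by
      change InnerModule.inn η (S _) = InnerModule.inn η (InnerModule.act (S ξ) a)
      rw [← h, InnerModule.inn_act, InnerModule.inn_act, h],
    h⟩

theorem ofInner_apply (T : E → F) (S : F → E)
    (h : ∀ ξ η, (InnerModule.inn (T ξ) η : A) = InnerModule.inn ξ (S η)) (ξ : E) :
    ofInner T S h ξ = T ξ := rfl

theorem sub_apply (T S : Adjointable A E F) (ξ : E) : (T - S) ξ = T ξ - S ξ := rfl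

theorem adj_sub (T S : Adjointable A E F) : (T - S).adj = T.adj - S.adj :=
  adj_eq fun ξ η => by rw [sub_apply, sub_apply, sub_inn, inn_sub, inn_adj, inn_adj]

theorem opSeminorm_smul {p : A → ℝ} (hp : IsCStarSeminorm p) (c : ℂ) {T : Adjointable A E F}
    (hT : T.IsBoundedAt p) : (c • T).opSeminorm p = ‖c‖ * T.opSeminorm p := by
  refine le_antisymm (opSeminorm_smul_le hp c hT) ?_
  rcases eq_or_ne c 0 with rfl | hc
  · rw [norm_zero, zero_mul]
    exact opSeminorm_nonneg _ _
  · have hcT : (c • T).IsBoundedAt p := ⟨‖c‖ * T.opSeminorm p, fun ξ => by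
      rw [smul_apply, vecSeminorm_smul hp, mul_assoc]
      exact mul_le_mul_of_nonneg_left (le_opSeminorm hp hT ξ) (norm_nonneg _)⟩
    have h := opSeminorm_smul_le hp c⁻¹ hcT
    rw [inv_smul_smul₀ hc, norm_inv] at h
    rwa [← le_inv_mul_iff₀ (norm_pos_iff.2 hc)]

end Adjointable

end Operators

section HilbertModule

variable {A : Type*} [NonUnitalRing A] [StarRing A] [Module ℂ A]
  [IsScalarTower ℂ A A] [SMulCommClass ℂ A A] [StarModule ℂ A]
  [TopologicalSpace A] [LocallyCStarAlgebra A]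
  {E : Type*} [AddCommGroup E] [Module ℂ E] [InnerModule A E] [HilbertModule A E]
  {F : Type*} [AddCommGroup F] [Module ℂ F] [InnerModule A F] [HilbertModule A F]

variable (A) in
theorem eq_of_forall_vecSeminorm_sub_eq_zero {E : Type*} [AddCommGroup E] [Module ℂ E]
    [InnerModule A E] {ξ η : E} (h : ∀ p ∈ contSeminorms A, vecSeminorm p (ξ - η) = 0) :
    ξ = η := by
  rw [← sub_eq_zero, ← InnerModule.inn_self_eq_zero (A := A)]
  refine eq_zero_of_forall_seminorm_eq_zero fun p hp => ?_
  rw [← vecSeminorm_sq hp.1, h p hp, zero_pow two_ne_zero]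

namespace Adjointable

/-- Ensures that `opSeminorm` is a true supremum: on an unbounded set the real `sSup` takes the
value `0`. -/
theorem isBoundedAt (T : Adjointable A E F) {p : A → ℝ} (hp : p ∈ contSeminorms A) :
    T.IsBoundedAt p :=
  let ⟨C, _, hC⟩ := T.exists_bound hp
  ⟨C, hC⟩

variable (A E F) in
/-- The seminorms `opSeminorm p` as a family of bundled seminorms. -/
def opSeminormFamily : SeminormFamily ℂ (Adjointable A E F) (contSeminorms A) := fun p =>
  Seminorm.of (opSeminorm p.1)
    (fun T S => opSeminorm_add_le (HilbertModule.isPositiveAt F p.2.1) (T.isBoundedAt p.2)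
      (S.isBoundedAt p.2))
    (fun c T => opSeminorm_smul p.2.1 c (T.isBoundedAt p.2))

variable (A E F) in
theorem withSeminorms_opSeminormFamily : WithSeminorms (opSeminormFamily A E F) :=
  withSeminorms_of_eq_seminormTopology (by
    change seminormTopology _ = seminormTopology _
    rw [Set.image_eq_range]
    rfl)

theorem eq_zero_of_forall_opSeminorm_eq_zero {T : Adjointable A E F}
    (h : ∀ p ∈ contSeminorms A, T.opSeminorm p = 0) : T = 0 := by
  refine ext fun ξ => eq_of_forall_vecSeminorm_sub_eq_zero A fun p hp => ?_
  rw [zero_apply, sub_zero]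
  have h1 := le_opSeminorm hp.1 (T.isBoundedAt hp) ξ
  rw [h p hp, zero_mul] at h1
  exact le_antisymm h1 (vecSeminorm_nonneg _ _)

theorem exists_pointwise_limit {f : Filter (Adjointable A E F)} [f.NeBot]
    (hf : ∀ p ∈ contSeminorms A, ∀ ε > 0, ∃ s ∈ f, ∀ T ∈ s, ∀ S ∈ s, opSeminorm p (T - S) < ε)
    (ξ : E) : ∃ η : F, ∀ p ∈ contSeminorms A,
      Tendsto (fun T : Adjointable A E F => vecSeminorm p (T ξ - η)) f (𝓝 0) := by
  obtain ⟨η, hη⟩ := HilbertModule.complete (A := A) (map (fun T : Adjointable A E F => T ξ) f)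
    inferInstance fun p hp ε hε => by
      have hξ := vecSeminorm_nonneg p ξ
      obtain ⟨s, hs, h⟩ := hf p hp (ε / (vecSeminorm p ξ + 1)) (by positivity)
      refine ⟨_, image_mem_map hs, ?_⟩
      rintro _ ⟨T, hT, rfl⟩ _ ⟨S, hS, rfl⟩
      have h1 := le_opSeminorm hp.1 ((T - S).isBoundedAt hp) ξ
      have h2 := mul_le_mul_of_nonneg_right (h T hT S hS).le hξ
      refine (h1.trans h2).trans_lt ?_
      rw [div_mul_eq_mul_div, div_lt_iff₀ (by positivity)]
      nlinarith
  exact ⟨η, hη⟩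

/-- Taking adjoints preserves operator seminorms, so both `T` and `T*` have pointwise limits along
the filter. The limits remain adjoint to each other, which by `ofInner` already makes them module
morphisms. -/
theorem exists_limit (f : Filter (Adjointable A E F)) (hne : f.NeBot)
    (hf : ∀ p ∈ contSeminorms A, ∀ ε > 0, ∃ s ∈ f, ∀ T ∈ s, ∀ S ∈ s, opSeminorm p (T - S) < ε) :
    ∃ T : Adjointable A E F, ∀ p ∈ contSeminorms A,
      Tendsto (fun S => opSeminorm p (S - T)) f (𝓝 0) := by
  have hf' : ∀ p ∈ contSeminorms A, ∀ ε > 0,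
      ∃ s ∈ map adj f, ∀ T ∈ s, ∀ S ∈ s, opSeminorm p (T - S) < ε := by
    intro p hp ε hε
    obtain ⟨s, hs, h⟩ := hf p hp ε hε
    refine ⟨_, image_mem_map hs, ?_⟩
    rintro _ ⟨T, hT, rfl⟩ _ ⟨S, hS, rfl⟩
    rw [← adj_sub, opSeminorm_adj (HilbertModule.isPositiveAt E hp.1)
      (HilbertModule.isPositiveAt F hp.1) ((T - S).isBoundedAt hp)]
    exact h T hT S hS
  choose T₀ hT₀ using exists_pointwise_limit hf
  choose S₀ hS₀ using exists_pointwise_limit hf'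
  have hadj : ∀ ξ η, (InnerModule.inn (T₀ ξ) η : A) = InnerModule.inn ξ (S₀ η) := by
    intro ξ η
    rw [← sub_eq_zero]
    refine eq_zero_of_forall_seminorm_eq_zero fun p hp => ?_
    have hE := HilbertModule.isPositiveAt E hp.1
    have hF := HilbertModule.isPositiveAt F hp.1
    have h1 : Tendsto (fun T : Adjointable A E F => vecSeminorm p (T ξ - T₀ ξ) * vecSeminorm p η +
        vecSeminorm p ξ * vecSeminorm p (T.adj η - S₀ η)) f (𝓝 0) := by
      have h2 := (hT₀ ξ p hp).mul_const (vecSeminorm p η)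
      have h3 : Tendsto (fun T : Adjointable A E F => vecSeminorm p (T.adj η - S₀ η)) f (𝓝 0) :=
        hS₀ η p hp
      have h4 := h2.add (h3.const_mul (vecSeminorm p ξ))
      rwa [zero_mul, mul_zero, add_zero] at h4
    refine le_antisymm (ge_of_tendsto' h1 fun T => ?_) (hp.1.nonneg _)
    have h5 : (InnerModule.inn (T₀ ξ) η - InnerModule.inn ξ (S₀ η) : A) =
        InnerModule.inn ξ (T.adj η - S₀ η) - InnerModule.inn (T ξ - T₀ ξ) η := by
      rw [inn_sub, sub_inn, inn_adj]
      abel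
    rw [h5]
    refine (hp.1.sub_le _ _).trans ?_
    rw [add_comm]
    exact add_le_add (hF.inn_le _ _) (hE.inn_le _ _)
  refine ⟨ofInner T₀ S₀ hadj, fun p hp => ?_⟩
  have hF := HilbertModule.isPositiveAt F hp.1
  rw [Metric.tendsto_nhds]
  intro ε hε
  obtain ⟨s, hs, h⟩ := hf p hp (ε / 2) (half_pos hε)
  filter_upwards [hs] with T hT
  rw [dist_zero_right, Real.norm_of_nonneg (opSeminorm_nonneg _ _)]
  refine lt_of_le_of_lt (opSeminorm_le _ (half_pos hε).le fun ξ => ?_) (half_lt_self hε)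
  refine le_of_forall_pos_le_add fun δ hδ => ?_
  -- `S` depends on `ξ` and `δ`, but the bound for `T - S` does not, so the estimate is uniform in
  -- `ξ`.
  obtain ⟨S, hS1, hS2⟩ := (((hT₀ ξ p hp).eventually_lt_const hδ).and hs).exists
  rw [sub_apply, ofInner_apply]
  have h1 := hF.sub_le_sub_add_sub (T ξ) (S ξ) (T₀ ξ)
  have h2 := le_opSeminorm hp.1 ((T - S).isBoundedAt hp) ξ
  have h3 := mul_le_mul_of_nonneg_right (h T hT S hS2).le (vecSeminorm_nonneg p ξ)
  rw [sub_apply] at h2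
  linarith

variable (A E F) in
theorem completeLocallyConvex : CompleteLocallyConvex (Adjointable A E F) :=
  completeLocallyConvex_of_withSeminorms (withSeminorms_opSeminormFamily A E F)
    (fun _ h => eq_zero_of_forall_opSeminorm_eq_zero fun p hp => h ⟨p, hp⟩)
    (fun f hne hf =>
      let ⟨T, hT⟩ := exists_limit f hne fun p hp => hf ⟨p, hp⟩
      ⟨T, fun p => hT p.1 p.2⟩)

theorem isCStarSeminorm_opSeminorm {p : A → ℝ} (hp : p ∈ contSeminorms A) :
    IsCStarSeminorm (opSeminorm p : Adjointable A E E → ℝ) where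
  add_le T S := opSeminorm_add_le (HilbertModule.isPositiveAt E hp.1) (T.isBoundedAt hp)
    (S.isBoundedAt hp)
  smul_eq c T := opSeminorm_smul hp.1 c (T.isBoundedAt hp)
  mul_le T S := opSeminorm_comp_le hp.1 (T.isBoundedAt hp) (S.isBoundedAt hp)
  star_mul_self T := opSeminorm_adj_comp (HilbertModule.isPositiveAt E hp.1)
    (HilbertModule.isPositiveAt E hp.1) (T.isBoundedAt hp)

variable (A E) in
theorem locallyCStarAlgebra : LocallyCStarAlgebra (Adjointable A E E) :=
  locallyCStarAlgebra_of_withSeminorms (withSeminorms_opSeminormFamily A E E)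
    (fun p => isCStarSeminorm_opSeminorm p.2)
    (fun _ h => eq_zero_of_forall_opSeminorm_eq_zero fun p hp => h ⟨p, hp⟩)
    (fun f hne hf =>
      let ⟨T, hT⟩ := exists_limit f hne fun p hp => hf ⟨p, hp⟩
      ⟨T, fun p => hT p.1 p.2⟩)

end Adjointable

end HilbertModule

/-! ### Seminorms on `M(A)` and `M(E)` -/

/-- Repeatedly replacing `a` by `a* a` gives `(p a / q a) ^ (2 ^ n) ≤ C` for all `n`, which rules
out a ratio above `1`. -/
theorem IsCStarSeminorm.le_of_le_mul {A : Type*} [NonUnitalRing A] [StarRing A] [Module ℂ A]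
    {p q : A → ℝ} (hp : IsCStarSeminorm p) (hq : IsCStarSeminorm q) {C : ℝ}
    (h : ∀ a, p a ≤ C * q a) (a : A) : p a ≤ q a := by
  have hpow : ∀ (n : ℕ) (a : A), p a ^ (2 ^ n) ≤ C * q a ^ (2 ^ n) := by
    intro n
    induction n with
    | zero => simpa using h
    | succ n ih =>
      intro a
      have h1 := ih (star a * a)
      rwa [hp.star_mul_self, hq.star_mul_self, ← pow_mul, ← pow_mul, ← pow_succ'] at h1
  rcases (hq.nonneg a).eq_or_lt with h0 | h0
  · have h1 := h a
    rw [← h0, mul_zero] at h1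
    rwa [← h0]
  · by_contra! hlt
    have h1 : 1 < p a / q a := (one_lt_div h0).2 hlt
    obtain ⟨n, hn⟩ := pow_unbounded_of_one_lt C h1
    have h2 : (p a / q a) ^ n ≤ (p a / q a) ^ (2 ^ n) :=
      pow_le_pow_right₀ h1.le Nat.lt_two_pow_self.le
    have h3 : (p a / q a) ^ (2 ^ n) ≤ C := by
      rw [div_pow, div_le_iff₀ (by positivity)]
      exact hpow n a
    linarith

section SmulOneSub

variable {A : Type*} [NonUnitalRing A] [StarRing A] [Module ℂ A]
  [IsScalarTower ℂ A A] [SMulCommClass ℂ A A] [StarModule ℂ A]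
  {E : Type*} [AddCommGroup E] [Module ℂ E] [InnerModule A E]
  {F : Type*} [AddCommGroup F] [Module ℂ F] [InnerModule A F]
  {p : A → ℝ} {hp : IsCStarSeminorm p} (hE : IsPositiveAt E hp) (hF : IsPositiveAt F hp)

include hE hF in
-- With `r` the squared seminorm of `T`, the inner square of `(r - T* T) ξ` is `r² ⟨ξ, ξ⟩ - 2r ⟨T ξ,
-- T ξ⟩ + ⟨T* T ξ, T* T ξ⟩`, and the last term is at most `r ⟨T ξ, T ξ⟩`. This serves to prove
-- positivity of `⟨s, s⟩` in `M(A)`.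
theorem Adjointable.opSeminorm_smul_one_sub_le {T : Adjointable A E F} (hT : T.IsBoundedAt p) :
    (((T.opSeminorm p ^ 2 : ℝ) : ℂ) • (1 : Adjointable A E E) - T.adj.comp T).opSeminorm p ≤
      T.opSeminorm p ^ 2 := by
  set r : ℝ := T.opSeminorm p ^ 2 with hr
  have hr0 : 0 ≤ r := sq_nonneg _
  refine opSeminorm_le _ hr0 fun ξ => ?_
  refine le_of_sq_le_sq ?_ (mul_nonneg hr0 (vecSeminorm_nonneg _ _))
  rw [mul_pow, vecSeminorm_sq hp, vecSeminorm_sq hp]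
  set π := toHull hp with hπ
  have hT' := isBoundedAt_adj hE hF hT
  have h1 : π (InnerModule.inn (T.adj (T ξ)) (T.adj (T ξ))) ≤
      r • π (InnerModule.inn (T ξ) (T ξ)) :=
    hF.inn_map_le hE T.adj (T ξ) hr0 fun n => by
      have := inn_pow_le hF hE hT' (T ξ) n
      rwa [opSeminorm_adj hE hF hT] at this
  have hcast : ∀ x : CStarHull hp, (r : ℂ) • x = r • x := fun x => Complex.coe_smul r x
  have hrs : star (r : ℂ) = r := Complex.conj_ofReal r
  have h2 : π (InnerModule.inn (((r : ℂ) • (1 : Adjointable A E E) - T.adj.comp T) ξ)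
      (((r : ℂ) • (1 : Adjointable A E E) - T.adj.comp T) ξ)) =
      r ^ 2 • π (InnerModule.inn ξ ξ) - (2 * r) • π (InnerModule.inn (T ξ) (T ξ)) +
        π (InnerModule.inn (T.adj (T ξ)) (T.adj (T ξ))) := by
    have h3 : ((r : ℂ) • (1 : Adjointable A E E) - T.adj.comp T) ξ =
        (r : ℂ) • ξ - T.adj (T ξ) := rfl
    have h4 : (InnerModule.inn ξ (T.adj (T ξ)) : A) = InnerModule.inn (T ξ) (T ξ) :=
      (inn_adj _ _ _).symm
    have h5 : (InnerModule.inn (T.adj (T ξ)) ξ : A) = InnerModule.inn (T ξ) (T ξ) :=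
      adj_inn _ _ _
    rw [h3]
    simp only [inn_sub, sub_inn, InnerModule.inn_smul, smul_inn, hrs, h4, h5, map_sub,
      _root_.map_smul, hcast]
    module
  have h6 : π (InnerModule.inn (((r : ℂ) • (1 : Adjointable A E E) - T.adj.comp T) ξ)
      (((r : ℂ) • (1 : Adjointable A E E) - T.adj.comp T) ξ)) ≤
        r ^ 2 • π (InnerModule.inn ξ ξ) := by
    rw [h2, ← sub_nonneg]
    have h7 : 0 ≤ r • π (InnerModule.inn (T ξ) (T ξ)) := smul_nonneg hr0 (hF (T ξ))
    refine (add_nonneg h7 (sub_nonneg.2 h1)).trans (le_of_eq ?_)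
    module
  have h8 := CStarAlgebra.norm_le_norm_of_nonneg_of_le (hE _) h6
  rwa [norm_smul, norm_toHull, norm_toHull, Real.norm_of_nonneg (by positivity)] at h8

end SmulOneSub

section Multipliers

variable {A : Type*} [NonUnitalRing A] [StarRing A] [Module ℂ A]
  [IsScalarTower ℂ A A] [SMulCommClass ℂ A A] [StarModule ℂ A]
  [TopologicalSpace A] [LocallyCStarAlgebra A]
  {E : Type*} [AddCommGroup E] [Module ℂ E] [InnerModule A E]
  {p : A → ℝ}

theorem vecSeminorm_self (hp : IsCStarSeminorm p) (a : A) : vecSeminorm p a = p a := by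
  change √(p (star a * a)) = p a
  rw [hp.star_mul_self, Real.sqrt_sq (hp.nonneg a)]

instance : HilbertModule A A where
  inn_self_nonneg a := ⟨a, rfl⟩
  complete f hf h := by
    obtain ⟨x, hx⟩ := exists_limit_of_cauchy f hf fun p hp ε hε => by
      obtain ⟨s, hs, hs'⟩ := h p hp ε hε
      refine ⟨s, hs, fun x hx y hy => ?_⟩
      rw [← vecSeminorm_self hp.1]
      exact hs' x hx y hy
    exact ⟨x, fun p hp => by simpa only [vecSeminorm_self hp.1] using hx p hp⟩

namespace Multiplier

theorem toAdjointable_ofAdjointable (T : Adjointable A A A) :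
    (ofAdjointable T).toAdjointable = T := rfl

theorem toAdjointable_sub (m n : Multiplier A) :
    (m - n).toAdjointable = m.toAdjointable - n.toAdjointable := rfl

theorem toAdjointable_smul (c : ℂ) (m : Multiplier A) :
    (c • m).toAdjointable = c • m.toAdjointable := rfl

theorem toAdjointable_mul (m n : Multiplier A) :
    (m * n).toAdjointable = m.toAdjointable * n.toAdjointable := rfl

theorem toAdjointable_one : (1 : Multiplier A).toAdjointable = 1 := rfl

theorem toAdjointable_star (m : Multiplier A) :
    (star m).toAdjointable = star m.toAdjointable :=
  (Adjointable.adj_eq fun a b => by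
    change star (m.left a) * b = star a * star (m.right (star b))
    rw [← star_mul, ← m.mul_left, star_mul, star_star]).symm

theorem toAdjointable_injective :
    Function.Injective (toAdjointable : Multiplier A → Adjointable A A A) := by
  intro m n h
  refine ext' (fun a => congrArg (fun T : Adjointable A A A => T a) h) fun a => ?_
  have h1 : (star m).toAdjointable = (star n).toAdjointable := by
    rw [toAdjointable_star, toAdjointable_star, h]
  have h2 : star (m.right (star (star a))) = star (n.right (star (star a))) :=
    congrArg (fun T : Adjointable A A A => T (star a)) h1
  rwa [star_star, star_inj] at h2

theorem seminorm_eq (hp : IsCStarSeminorm p) (m : Multiplier A) :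
    seminorm p m = m.toAdjointable.opSeminorm p := by
  unfold seminorm Adjointable.opSeminorm
  simp only [vecSeminorm_self hp]
  rfl

theorem isCStarSeminorm_seminorm (hp : p ∈ contSeminorms A) :
    IsCStarSeminorm (seminorm p : Multiplier A → ℝ) where
  add_le m n := by
    simp only [seminorm_eq hp.1]
    exact (Adjointable.isCStarSeminorm_opSeminorm (E := A) hp).add_le
      m.toAdjointable n.toAdjointable
  smul_eq c m := by
    simp only [seminorm_eq hp.1]
    exact (Adjointable.isCStarSeminorm_opSeminorm (E := A) hp).smul_eq c m.toAdjointable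
  mul_le m n := by
    simp only [seminorm_eq hp.1]
    exact (Adjointable.isCStarSeminorm_opSeminorm (E := A) hp).mul_le
      m.toAdjointable n.toAdjointable
  star_mul_self m := by
    simp only [seminorm_eq hp.1, toAdjointable_mul, toAdjointable_star]
    exact (Adjointable.isCStarSeminorm_opSeminorm (E := A) hp).star_mul_self m.toAdjointable

theorem seminorm_mem_contSeminorms (hp : p ∈ contSeminorms A) :
    (seminorm p : Multiplier A → ℝ) ∈ contSeminorms (Multiplier A) := by
  refine ⟨isCStarSeminorm_seminorm hp, ?_⟩
  have h : (inferInstance : TopologicalSpace (Multiplier A)) ≤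
      TopologicalSpace.induced (fun m => seminorm p (m - 0)) inferInstance :=
    (iInf₂_le (seminorm p) ⟨p, hp, rfl⟩).trans (iInf_le _ 0)
  simpa only [sub_zero] using continuous_iff_le_induced.2 h

variable (A) in
/-- The defining seminorms of `M(A)`. -/
def seminormFamily : SeminormFamily ℂ (Multiplier A) (contSeminorms A) := fun p =>
  (isCStarSeminorm_seminorm p.2).toSeminorm

variable (A) in
theorem withSeminorms_seminormFamily : WithSeminorms (seminormFamily A) :=
  withSeminorms_of_eq_seminormTopology (by
    change seminormTopology _ = seminormTopology _
    rw [Set.image_eq_range]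
    rfl)

theorem seminorm_mono {q : A → ℝ} (hp : p ∈ contSeminorms A) (hq : q ∈ contSeminorms A)
    (hpq : ∀ a, p a ≤ q a) (m : Multiplier A) : seminorm p m ≤ seminorm q m := by
  rw [seminorm_eq hp.1, seminorm_eq hq.1]
  exact Adjointable.opSeminorm_mono (HilbertModule.isPositiveAt A hq.1)
    (HilbertModule.isPositiveAt A hq.1) (HilbertModule.isPositiveAt A hp.1)
    (HilbertModule.isPositiveAt A hp.1) hpq (m.toAdjointable.isBoundedAt hq)

theorem exists_seminormFamily_le (s : Finset (contSeminorms A)) :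
    ∃ p : contSeminorms A, ∀ i ∈ s, seminormFamily A i ≤ seminormFamily A p := by
  induction s using Finset.cons_induction with
  | empty => exact ⟨⟨_, zero_mem_contSeminorms⟩, by simp⟩
  | cons i s hi ih =>
    obtain ⟨p, hp⟩ := ih
    have hmem := sup_mem_contSeminorms i.2 p.2
    refine ⟨⟨_, hmem⟩, fun j hj => ?_⟩
    rcases Finset.mem_cons.1 hj with rfl | hj
    · exact fun m => seminorm_mono j.2 hmem (fun a => le_max_left _ _) m
    · exact (hp j hj).trans fun m => seminorm_mono p.2 hmem (fun a => le_max_right _ _) m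

/-- Continuity bounds `P` by a constant times a finite join of defining seminorms. Directedness
replaces the join by a single one, and `le_of_le_mul` removes the constant. -/
theorem exists_le_seminorm {P : Multiplier A → ℝ} (hP : P ∈ contSeminorms (Multiplier A)) :
    ∃ p ∈ contSeminorms A, ∀ m, P m ≤ seminorm p m := by
  obtain ⟨s, C, -, hC⟩ := Seminorm.bound_of_continuous (withSeminorms_seminormFamily A)
    hP.1.toSeminorm hP.2
  obtain ⟨p, hp⟩ := exists_seminormFamily_le s
  refine ⟨p.1, p.2, fun m => ?_⟩
  refine hP.1.le_of_le_mul (isCStarSeminorm_seminorm p.2) (C := C) (fun m => ?_) m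
  refine (hC m).trans ?_
  exact mul_le_mul_of_nonneg_left (Finset.sup_le hp m) C.2

theorem eq_zero_of_forall_seminorm_eq_zero {m : Multiplier A}
    (h : ∀ p ∈ contSeminorms A, seminorm p m = 0) : m = 0 :=
  toAdjointable_injective (Adjointable.eq_zero_of_forall_opSeminorm_eq_zero fun p hp => by
    rw [← seminorm_eq hp.1, h p hp])

end Multiplier

namespace MultiplierModule

open Multiplier

theorem toAdjointable_inn (s t : MultiplierModule A E) :
    (InnerModule.inn s t : Multiplier A).toAdjointable = s.adj.comp t := rfl

variable [HilbertModule A E]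

theorem vecSeminorm_eq (hp : p ∈ contSeminorms A) (s : MultiplierModule A E) :
    vecSeminorm (seminorm p) s = s.opSeminorm p := by
  rw [vecSeminorm, seminorm_eq hp.1, toAdjointable_inn,
    Adjointable.opSeminorm_adj_comp (HilbertModule.isPositiveAt A hp.1)
      (HilbertModule.isPositiveAt E hp.1) (s.isBoundedAt hp),
    Real.sqrt_sq (Adjointable.opSeminorm_nonneg _ _)]

variable (E) in
-- No factorization of `⟨s, s⟩` as `m* m` in `M(A)` is needed: a self-adjoint `c` with `‖r - c‖ ≤ r`
-- is positive.
theorem isPositiveAt {P : Multiplier A → ℝ} (hP : P ∈ contSeminorms (Multiplier A)) :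
    IsPositiveAt (MultiplierModule A E) hP.1 := by
  intro s
  obtain ⟨p, hp, hPp⟩ := exists_le_seminorm hP
  set r : ℝ := s.opSeminorm p ^ 2 with hr
  set c : Multiplier A := InnerModule.inn s s with hc
  have h1 : P ((r : ℂ) • 1 - c) ≤ r := by
    refine (hPp _).trans ?_
    rw [seminorm_eq hp.1, toAdjointable_sub, toAdjointable_smul, toAdjointable_one, hc,
      toAdjointable_inn]
    exact Adjointable.opSeminorm_smul_one_sub_le (HilbertModule.isPositiveAt A hp.1)
      (HilbertModule.isPositiveAt E hp.1) (s.isBoundedAt hp)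
  set π := toHull hP.1 with hπ
  set x : CStarHull hP.1 := π ((r : ℂ) • 1 - c) with hx
  have hcs : star c = c := InnerModule.star_inn s s
  have hrs : star (r : ℂ) = r := Complex.conj_ofReal r
  have hxs : IsSelfAdjoint x := by
    rw [IsSelfAdjoint, hx, ← map_star, star_sub, star_smul, hrs, hcs, star_one]
  -- `π` need not preserve the unit; `π 1` is only a projection, and it replaces `1` in the
  -- comparison.
  have h2 : x ≤ r • (star (π 1) * π 1) := by
    have h3 : star (π 1) * x * π 1 = x := by
      rw [hx, ← map_star, ← map_mul, ← map_mul, star_one, one_mul, mul_one]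
    rw [← h3]
    refine (CStarAlgebra.star_left_conjugate_le_norm_smul hxs).trans ?_
    refine smul_le_smul_of_nonneg_right ?_ (star_mul_self_nonneg _)
    rw [hx, norm_toHull]
    exact h1
  have h4 : π c = r • (star (π 1) * π 1) - x := by
    rw [hx, map_sub, map_smul, ← map_star, ← map_mul, star_one, one_mul, ← Complex.coe_smul,
      sub_sub_cancel]
  rw [h4]
  exact sub_nonneg.2 h2

variable (A) in
-- For the lower bound, the adjoint of `embed ξ` maps `ξ` to `⟨ξ, ξ⟩`, whose seminorm is the square
-- of that of `ξ`.
theorem opSeminorm_embed (hp : p ∈ contSeminorms A) (ξ : E) :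
    (embed ξ : MultiplierModule A E).opSeminorm p = vecSeminorm p ξ := by
  have hA := HilbertModule.isPositiveAt A hp.1
  have hE := HilbertModule.isPositiveAt E hp.1
  have hb := (embed ξ : MultiplierModule A E).isBoundedAt hp
  refine le_antisymm (Adjointable.opSeminorm_le _ (vecSeminorm_nonneg _ _) fun a => ?_) ?_
  · rw [vecSeminorm_self hp.1]
    exact vecSeminorm_act_le hp.1 ξ a
  · have h1 := Adjointable.le_opSeminorm hp.1 (Adjointable.isBoundedAt_adj hA hE hb) ξ
    have h2 : (embed ξ : MultiplierModule A E).adj ξ = InnerModule.inn ξ ξ := by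
      refine ext_inn A fun a => ?_
      rw [← Adjointable.inn_adj]
      exact act_inn ξ a ξ
    rw [Adjointable.opSeminorm_adj hA hE hb, h2, vecSeminorm_self hp.1, ← vecSeminorm_sq hp.1,
      sq] at h1
    rcases (vecSeminorm_nonneg p ξ).eq_or_lt with h | h
    · rw [← h]
      exact Adjointable.opSeminorm_nonneg _ _
    · exact le_of_mul_le_mul_right h1 h

theorem vecSeminorm_embed (hp : p ∈ contSeminorms A) (ξ : E) :
    vecSeminorm (seminorm p) (embed ξ : MultiplierModule A E) = vecSeminorm p ξ := by
  rw [vecSeminorm_eq hp, opSeminorm_embed A hp]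

end MultiplierModule

end Multipliers

/-! ### Restriction from `M(E)` to `E` and its inverse -/

section Restriction

variable {A : Type*} [NonUnitalRing A] [StarRing A] [Module ℂ A]
  [IsScalarTower ℂ A A] [SMulCommClass ℂ A A] [StarModule ℂ A]
  [TopologicalSpace A] [LocallyCStarAlgebra A]
  {E : Type*} [AddCommGroup E] [Module ℂ E] [InnerModule A E]
  {F : Type*} [AddCommGroup F] [Module ℂ F] [InnerModule A F]
  {p : A → ℝ}

namespace MultiplierModule

open Multiplier

theorem embed_apply (ξ : E) (a : A) : (embed ξ : MultiplierModule A E) a = InnerModule.act ξ a :=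
  rfl

theorem embed_add (ξ η : E) :
    (embed (ξ + η) : MultiplierModule A E) = embed ξ + embed η :=
  Adjointable.ext fun a => InnerModule.add_act ξ η a

theorem embed_smul (c : ℂ) (ξ : E) :
    (embed (c • ξ) : MultiplierModule A E) = c • embed ξ :=
  Adjointable.ext fun a => InnerModule.smul_act c ξ a

theorem embed_neg (ξ : E) : (embed (-ξ) : MultiplierModule A E) = -embed ξ := by
  rw [← neg_one_smul ℂ ξ, embed_smul, neg_one_smul]

theorem embed_sub (ξ η : E) :
    (embed (ξ - η) : MultiplierModule A E) = embed ξ - embed η := by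
  rw [sub_eq_add_neg, embed_add, embed_neg, ← sub_eq_add_neg]

/-- An element of `A` as a multiplier. -/
def ofElement (a : A) : Multiplier A := ofAdjointable (embed a)

/-- Elements of `A` multiply `M(E)` into `E`; through this identity an operator on `M(E)` is
determined by its values on `E`. -/
theorem act_ofElement (s : MultiplierModule A E) (a : A) :
    InnerModule.act s (ofElement a) = (embed (s a) : MultiplierModule A E) :=
  Adjointable.ext fun b => s.map_act a b

theorem inn_embed_embed (ξ η : E) :
    (InnerModule.inn (embed ξ : MultiplierModule A E) (embed η) : Multiplier A) =
      ofElement (InnerModule.inn ξ η) := by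
  refine toAdjointable_injective (Adjointable.ext fun a => ?_)
  rw [toAdjointable_inn, Adjointable.comp_apply]
  refine ext_inn A fun b => ?_
  rw [← Adjointable.inn_adj, embed_apply, embed_apply, act_inn, InnerModule.inn_act]
  rfl

theorem seminorm_ofElement (hp : p ∈ contSeminorms A) (a : A) :
    seminorm p (ofElement a) = p a := by
  rw [seminorm_eq hp.1, ofElement, toAdjointable_ofAdjointable, opSeminorm_embed A hp,
    vecSeminorm_self hp.1]

theorem ofElement_injective : Function.Injective (ofElement : A → Multiplier A) := by
  intro a b h
  rw [← sub_eq_zero]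
  refine LocallyCStar.eq_zero_of_forall_seminorm_eq_zero fun p hp => ?_
  have h1 : ofElement (a - b) = ofElement a - ofElement b :=
    toAdjointable_injective (embed_sub a b)
  rw [← seminorm_ofElement hp, h1, h, sub_self, (isCStarSeminorm_seminorm hp).map_zero]

theorem embed_injective [HilbertModule A E] :
    Function.Injective (embed : E → MultiplierModule A E) := by
  intro ξ η h
  refine eq_of_forall_vecSeminorm_sub_eq_zero A fun p hp => ?_
  rw [← vecSeminorm_embed hp, embed_sub, h, sub_self,
    vecSeminorm_zero (isCStarSeminorm_seminorm hp)]

end MultiplierModule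

open Multiplier MultiplierModule

variable [HilbertModule A E] [HilbertModule A F]

namespace Adjointable

/-- Estimate of `T (ξ w)` in terms of `ξ w` which does not use the boundedness of `T`. -/
theorem vecSeminorm_apply_embed_sq_le
    (T : Adjointable (Multiplier A) (MultiplierModule A E) (MultiplierModule A F))
    (hp : p ∈ contSeminorms A) (ξ : E) (w : A) :
    vecSeminorm p (T (embed ξ) w) ^ 2 ≤ vecSeminorm p (InnerModule.act ξ w) *
      (vecSeminorm (seminorm p) (T.adj (T (embed ξ))) * p w) := by
  have hP := seminorm_mem_contSeminorms hp
  have h1 : (embed (T (embed ξ) w) : MultiplierModule A F) =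
      T (embed (InnerModule.act ξ w)) := by
    rw [← act_ofElement, ← map_act, act_ofElement, embed_apply]
  rw [← vecSeminorm_embed hp, h1, vecSeminorm_sq hP.1, inn_adj]
  refine ((MultiplierModule.isPositiveAt E hP).inn_le _ _).trans ?_
  rw [vecSeminorm_embed hp]
  refine mul_le_mul_of_nonneg_left ?_ (vecSeminorm_nonneg _ _)
  -- Module linearity moves `w` out of `T* T`, so only the fixed vector `T* T (embed ξ)` enters the
  -- bound.
  have h2 : T.adj (T (embed (InnerModule.act ξ w))) =
      InnerModule.act (T.adj (T (embed ξ))) (ofElement w) := by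
    rw [← map_act, ← map_act, act_ofElement, embed_apply]
  rw [h2, ← seminorm_ofElement hp w]
  exact vecSeminorm_act_le hP.1 _ _

/-- Adjointable operators between multiplier modules map `E` into `F`. -/
theorem exists_apply_embed_eq
    (T : Adjointable (Multiplier A) (MultiplierModule A E) (MultiplierModule A F)) (ξ : E) :
    ∃ η : F, T (embed ξ) = embed η := by
  have hδ : ∀ n : ℕ, (0 : ℝ) < 1 / ((n : ℝ) + 1) := fun n => Nat.one_div_pos_of_nat
  -- Since `ξ + ξ (a n)` tends to `0`, the vectors `-ξ (a n)` tend to `ξ`. Their images under `T`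
  -- are the embedded vectors `-T (embed ξ) (a n)`, which explains the sign of the limit below.
  choose a ha using fun n : ℕ => exists_cutoff A ξ (hδ n)
  have hlim : Tendsto (fun n : ℕ => 1 / ((n : ℝ) + 1)) atTop (𝓝 0) :=
    tendsto_one_div_add_atTop_nhds_zero_nat
  obtain ⟨η, hη⟩ := HilbertModule.complete (A := A) (map (fun n => T (embed ξ) (a n)) atTop)
    inferInstance fun p hp ε hε => by
      set K := vecSeminorm (seminorm p) (T.adj (T (embed ξ))) with hK
      have hK0 : 0 ≤ K := vecSeminorm_nonneg _ _
      have hlim' : Tendsto (fun n : ℕ => 1 / ((n : ℝ) + 1) * (K * 2)) atTop (𝓝 0) := by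
        simpa using hlim.mul_const (K * 2)
      obtain ⟨N, hN⟩ := (hlim'.eventually_lt_const (by positivity : 0 < ε ^ 2)).exists
      refine ⟨_, image_mem_map (Ici_mem_atTop N), ?_⟩
      rintro _ ⟨n, hn, rfl⟩ _ ⟨m, hm, rfl⟩
      have hn' : 1 / ((n : ℝ) + 1) ≤ 1 / ((N : ℝ) + 1) := Nat.one_div_le_one_div hn
      have hm' : 1 / ((m : ℝ) + 1) ≤ 1 / ((N : ℝ) + 1) := Nat.one_div_le_one_div hm
      have h1 : T (embed ξ) (a n) - T (embed ξ) (a m) = T (embed ξ) (a n - a m) :=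
        ((T (embed ξ)).1.map_sub _ _).symm
      have h2 := T.vecSeminorm_apply_embed_sq_le hp ξ (a n - a m)
      have h3 : vecSeminorm p (InnerModule.act ξ (a n - a m)) ≤ 1 / ((N : ℝ) + 1) := by
        have h4 : InnerModule.act ξ (a n - a m) =
            (ξ + InnerModule.act ξ (a n)) - (ξ + InnerModule.act ξ (a m)) := by
          rw [act_sub, add_sub_add_left_eq_sub]
        rw [h4]
        have h5 := (HilbertModule.isPositiveAt E hp.1).sub_le (ξ + InnerModule.act ξ (a n))
          (ξ + InnerModule.act ξ (a m))
        have h6 := (ha n p hp).2.1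
        have h7 := (ha m p hp).2.1
        linarith
      have h4 : p (a n - a m) ≤ 2 := by
        have h5 := hp.1.sub_le (a n) (a m)
        have h6 := (ha n p hp).1
        have h7 := (ha m p hp).1
        linarith
      have h5 : K * p (a n - a m) ≤ K * 2 := mul_le_mul_of_nonneg_left h4 hK0
      have h6 := mul_le_mul h3 h5 (mul_nonneg hK0 (hp.1.nonneg _)) (hδ N).le
      rw [h1]
      exact lt_of_pow_lt_pow_left₀ 2 hε.le ((h2.trans h6).trans_lt hN)
  refine ⟨-η, ?_⟩
  rw [embed_neg, ← sub_eq_zero, sub_neg_eq_add]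
  -- Pairing with `s` moves `T` over to `T*`, so Cauchy–Schwarz suffices where a bound for `T` is
  -- not available.
  refine ext_inn (Multiplier A) fun s => ?_
  rw [inn_zero]
  refine Multiplier.eq_zero_of_forall_seminorm_eq_zero fun p hp => ?_
  have hP := seminorm_mem_contSeminorms hp
  have h1 : Tendsto (fun n : ℕ =>
      vecSeminorm (seminorm p) (T.adj s) * (1 / ((n : ℝ) + 1) / 2) +
        vecSeminorm (seminorm p) s * vecSeminorm p (T (embed ξ) (a n) - η)) atTop (𝓝 0) := by
    have h2 : Tendsto (fun n => vecSeminorm p (T (embed ξ) (a n) - η)) atTop (𝓝 0) := hη p hp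
    have h3 := ((hlim.div_const 2).const_mul (vecSeminorm (seminorm p) (T.adj s))).add
      (h2.const_mul (vecSeminorm (seminorm p) s))
    rwa [zero_div, mul_zero, mul_zero, add_zero] at h3
  refine le_antisymm (ge_of_tendsto' h1 fun n => ?_) (hP.1.nonneg _)
  have h2 : T (embed ξ) + embed η = T (embed (ξ + InnerModule.act ξ (a n))) -
      embed (T (embed ξ) (a n) - η) := by
    rw [embed_add, map_add, embed_sub, ← act_ofElement (T (embed ξ)), ← map_act, act_ofElement,
      embed_apply]
    abel
  rw [h2, inn_sub, ← adj_inn]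
  refine (hP.1.sub_le _ _).trans (add_le_add ?_ ?_)
  · refine ((MultiplierModule.isPositiveAt E hP).inn_le _ _).trans ?_
    rw [vecSeminorm_embed hp]
    exact mul_le_mul_of_nonneg_left (ha n p hp).2.1 (vecSeminorm_nonneg _ _)
  · refine ((MultiplierModule.isPositiveAt F hP).inn_le _ _).trans ?_
    rw [vecSeminorm_embed hp]

/-- The restriction of an adjointable operator `M(E) → M(F)` to an operator `E → F`. -/
def restrict (T : Adjointable (Multiplier A) (MultiplierModule A E) (MultiplierModule A F)) :
    Adjointable A E F :=
  ofInner (fun ξ => (T.exists_apply_embed_eq ξ).choose)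
    (fun η => (T.adj.exists_apply_embed_eq η).choose) fun ξ η => by
      refine ofElement_injective ?_
      rw [← inn_embed_embed, ← inn_embed_embed, ← (T.exists_apply_embed_eq ξ).choose_spec,
        ← (T.adj.exists_apply_embed_eq η).choose_spec, inn_adj]

theorem apply_embed (T : Adjointable (Multiplier A) (MultiplierModule A E) (MultiplierModule A F))
    (ξ : E) : T (embed ξ) = embed (T.restrict ξ) :=
  (T.exists_apply_embed_eq ξ).choose_spec

/-- Evaluate at `a` and embed: `T s · a = T (s · a) = T (embed (s a))`, where `T` acts by its
restriction. -/
theorem apply_eq_restrict_comp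
    (T : Adjointable (Multiplier A) (MultiplierModule A E) (MultiplierModule A F))
    (s : MultiplierModule A E) : T s = T.restrict.comp s := by
  refine ext fun a => embed_injective (A := A) ?_
  rw [← act_ofElement, ← map_act, act_ofElement, apply_embed, comp_apply]

/-- The extension of `S : E → F` to `M(E) → M(F)`, given by composition with `S`. -/
def extend (S : Adjointable A E F) :
    Adjointable (Multiplier A) (MultiplierModule A E) (MultiplierModule A F) :=
  ofInner (fun s => S.comp s) (fun t => S.adj.comp t) fun s t => by
    refine toAdjointable_injective ?_
    rw [toAdjointable_inn, toAdjointable_inn, adj_comp]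
    rfl

theorem extend_apply (S : Adjointable A E F) (s : MultiplierModule A E) :
    S.extend s = S.comp s := rfl

theorem extend_restrict
    (T : Adjointable (Multiplier A) (MultiplierModule A E) (MultiplierModule A F)) :
    T.restrict.extend = T :=
  ext fun s => (T.apply_eq_restrict_comp s).symm

theorem restrict_extend (S : Adjointable A E F) : S.extend.restrict = S := by
  refine ext fun ξ => embed_injective (A := A) ?_
  rw [← apply_embed, extend_apply]
  exact ext fun a => S.map_act ξ a

theorem restrict_add
    (S T : Adjointable (Multiplier A) (MultiplierModule A E) (MultiplierModule A F)) :
    (S + T).restrict = S.restrict + T.restrict :=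
  ext fun ξ => embed_injective (A := A) (by
    rw [← apply_embed, add_apply, add_apply, embed_add, ← apply_embed, ← apply_embed])

theorem restrict_smul (c : ℂ)
    (T : Adjointable (Multiplier A) (MultiplierModule A E) (MultiplierModule A F)) :
    (c • T).restrict = c • T.restrict :=
  ext fun ξ => embed_injective (A := A) (by
    rw [← apply_embed, smul_apply, smul_apply, embed_smul, ← apply_embed])

theorem restrict_mul
    (S T : Adjointable (Multiplier A) (MultiplierModule A E) (MultiplierModule A E)) :
    (S * T).restrict = S.restrict * T.restrict :=
  ext fun ξ => embed_injective (A := A) (by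
    rw [← apply_embed, mul_apply, mul_apply, apply_embed, apply_embed])

theorem restrict_adj
    (T : Adjointable (Multiplier A) (MultiplierModule A E) (MultiplierModule A F)) :
    T.adj.restrict = T.restrict.adj :=
  (adj_eq fun ξ η => ofElement_injective (by
    rw [← inn_embed_embed, ← inn_embed_embed, ← apply_embed, ← apply_embed, inn_adj])).symm

variable (A E F) in
/-- Restriction to `E` as a linear isomorphism. -/
def restrictEquiv :
    Adjointable (Multiplier A) (MultiplierModule A E) (MultiplierModule A F) ≃ₗ[ℂ]
      Adjointable A E F where
  toFun := restrict
  invFun := extend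
  map_add' := restrict_add
  map_smul' := restrict_smul
  left_inv := extend_restrict
  right_inv := restrict_extend

theorem isBoundedAt_seminorm
    (T : Adjointable (Multiplier A) (MultiplierModule A E) (MultiplierModule A F))
    (hp : p ∈ contSeminorms A) : T.IsBoundedAt (seminorm p) :=
  ⟨T.restrict.opSeminorm p, fun s => by
    rw [apply_eq_restrict_comp, vecSeminorm_eq hp, vecSeminorm_eq hp]
    exact opSeminorm_comp_le hp.1 (T.restrict.isBoundedAt hp) (s.isBoundedAt hp)⟩

/-- One inequality holds because `embed` is isometric, the other because `T` is composition with its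
restriction and operator seminorms are submultiplicative. -/
theorem opSeminorm_restrict
    (T : Adjointable (Multiplier A) (MultiplierModule A E) (MultiplierModule A F))
    (hp : p ∈ contSeminorms A) : T.restrict.opSeminorm p = T.opSeminorm (seminorm p) := by
  refine le_antisymm (opSeminorm_le _ (opSeminorm_nonneg _ _) fun ξ => ?_)
    (opSeminorm_le _ (opSeminorm_nonneg _ _) fun s => ?_)
  · rw [← vecSeminorm_embed hp, ← vecSeminorm_embed hp, ← apply_embed]
    exact le_opSeminorm (isCStarSeminorm_seminorm hp) (T.isBoundedAt_seminorm hp) _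
  · rw [apply_eq_restrict_comp, vecSeminorm_eq hp, vecSeminorm_eq hp]
    exact opSeminorm_comp_le hp.1 (T.restrict.isBoundedAt hp) (s.isBoundedAt hp)

variable (A E F) in
/-- The seminorms on `L(M(E), M(F))` associated with the seminorms of `A`. -/
def multiplierSeminormFamily : SeminormFamily ℂ
    (Adjointable (Multiplier A) (MultiplierModule A E) (MultiplierModule A F))
    (contSeminorms A) := fun p =>
  (opSeminormFamily A E F p).comp (restrictEquiv A E F).toLinearMap

theorem multiplierSeminormFamily_apply (p : contSeminorms A)
    (T : Adjointable (Multiplier A) (MultiplierModule A E) (MultiplierModule A F)) :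
    multiplierSeminormFamily A E F p T = T.opSeminorm (seminorm p.1) :=
  T.opSeminorm_restrict p.2

variable (A E F) in
/-- Each continuous `C*`-seminorm of `M(A)` gives a seminorm on `L(M(E), M(F))`, which is dominated
by one of those associated with the seminorms of `A`. -/
theorem exists_seminorm_le_multiplierSeminormFamily {P : Multiplier A → ℝ}
    (hP : P ∈ contSeminorms (Multiplier A)) :
    ∃ N : Seminorm ℂ (Adjointable (Multiplier A) (MultiplierModule A E) (MultiplierModule A F)),
      (∀ T, N T = opSeminorm P T) ∧ ∃ p, N ≤ multiplierSeminormFamily A E F p := by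
  obtain ⟨p, hp, hPp⟩ := exists_le_seminorm hP
  have hp' := seminorm_mem_contSeminorms hp
  have hE := MultiplierModule.isPositiveAt E hP
  have hF := MultiplierModule.isPositiveAt F hP
  have hE' := MultiplierModule.isPositiveAt E hp'
  have hF' := MultiplierModule.isPositiveAt F hp'
  have hb : ∀ T : Adjointable (Multiplier A) (MultiplierModule A E) (MultiplierModule A F),
      T.IsBoundedAt P := fun T =>
    ⟨_, map_le_of_seminorm_le hE' hF' hE hF hPp (T.isBoundedAt_seminorm hp)⟩
  refine ⟨Seminorm.of (opSeminorm P) (fun S T => opSeminorm_add_le hF (hb S) (hb T))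
    (fun c T => opSeminorm_smul hP.1 c (hb T)), fun T => rfl, ⟨p, hp⟩, fun T => ?_⟩
  rw [multiplierSeminormFamily_apply]
  exact opSeminorm_mono hE' hF' hE hF hPp (T.isBoundedAt_seminorm hp)

variable (A E F) in
-- The seminorms `p_{M(A)}` are among the continuous `C*`-seminorms of `M(A)`, and every other one
-- gives an operator seminorm dominated by one of theirs, so both families define the same topology.
theorem withSeminorms_multiplierSeminormFamily :
    WithSeminorms (multiplierSeminormFamily A E F) := by
  refine withSeminorms_of_eq_seminormTopology (le_antisymm ?_ ?_)
  · refine le_iInf₂ fun q hq => ?_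
    obtain ⟨p, rfl⟩ := hq
    refine iInf₂_le _ ⟨seminorm p.1, seminorm_mem_contSeminorms p.2, ?_⟩
    exact funext fun T => (multiplierSeminormFamily_apply p T).symm
  · let _ : TopologicalSpace
        (Adjointable (Multiplier A) (MultiplierModule A E) (MultiplierModule A F)) :=
      seminormTopology (Set.range fun p =>
        (multiplierSeminormFamily A E F p :
          Adjointable (Multiplier A) (MultiplierModule A E) (MultiplierModule A F) → ℝ))
    have hN : WithSeminorms (multiplierSeminormFamily A E F) :=
      withSeminorms_of_eq_seminormTopology rfl
    have := hN.topologicalAddGroup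
    refine le_iInf₂ fun q hq => le_iInf fun T₀ => ?_
    obtain ⟨P, hP, rfl⟩ := hq
    obtain ⟨N, hNP, p, hp⟩ := exists_seminorm_le_multiplierSeminormFamily A E F hP
    have hcont : Continuous N := Seminorm.continuous_of_le (hN.continuous_seminorm p) hp
    rw [← continuous_iff_le_induced]
    have h := hcont.comp (continuous_id.sub (continuous_const (y := T₀)))
    exact h.congr fun T => hNP _

theorem eq_zero_of_forall_multiplierSeminormFamily_eq_zero
    {T : Adjointable (Multiplier A) (MultiplierModule A E) (MultiplierModule A F)}
    (h : ∀ p, multiplierSeminormFamily A E F p T = 0) : T = 0 :=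
  (restrictEquiv A E F).map_eq_zero_iff.1
    (eq_zero_of_forall_opSeminorm_eq_zero fun p hp => h ⟨p, hp⟩)

theorem exists_limit_multiplier
    (f : Filter (Adjointable (Multiplier A) (MultiplierModule A E) (MultiplierModule A F)))
    (hne : f.NeBot) (hf : ∀ p, ∀ ε > 0, ∃ s ∈ f, ∀ T ∈ s, ∀ S ∈ s,
      multiplierSeminormFamily A E F p (T - S) < ε) :
    ∃ T, ∀ p, Tendsto (fun S => multiplierSeminormFamily A E F p (S - T)) f (𝓝 0) := by
  obtain ⟨T, hT⟩ := exists_limit (map (restrictEquiv A E F) f) inferInstance fun p hp ε hε => by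
    obtain ⟨s, hs, h⟩ := hf ⟨p, hp⟩ ε hε
    refine ⟨_, image_mem_map hs, ?_⟩
    rintro _ ⟨T, hT, rfl⟩ _ ⟨S, hS, rfl⟩
    rw [← _root_.map_sub]
    exact h T hT S hS
  refine ⟨T.extend, fun p => ?_⟩
  have h : Tendsto (fun S => opSeminorm p.1 (restrictEquiv A E F S - T)) f (𝓝 0) := hT p.1 p.2
  refine h.congr fun S => ?_
  change _ = opSeminorm p.1 (restrictEquiv A E F (S - T.extend))
  rw [_root_.map_sub]
  congr 2
  exact (restrict_extend T).symm

variable (A E F) in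
/-- Restriction to `E` as an isomorphism of locally convex spaces. -/
def restrictCLE :
    Adjointable (Multiplier A) (MultiplierModule A E) (MultiplierModule A F) ≃L[ℂ]
      Adjointable A E F where
  __ := restrictEquiv A E F
  continuous_toFun :=
    have := (withSeminorms_multiplierSeminormFamily A E F).topologicalAddGroup
    WithSeminorms.continuous_of_continuous_comp
      (withSeminorms_opSeminormFamily A E F)
      (restrictEquiv A E F).toLinearMap fun p =>
        (withSeminorms_multiplierSeminormFamily A E F).continuous_seminorm p
  continuous_invFun := by
    have := (withSeminorms_opSeminormFamily A E F).topologicalAddGroup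
    refine WithSeminorms.continuous_of_continuous_comp
      (withSeminorms_multiplierSeminormFamily A E F)
      (restrictEquiv A E F).symm.toLinearMap fun p => ?_
    refine ((withSeminorms_opSeminormFamily A E F).continuous_seminorm p).congr fun T => ?_
    exact congrArg (opSeminorm p.1) (restrict_extend T).symm

theorem isCStarSeminorm_multiplierSeminormFamily (p : contSeminorms A) :
    IsCStarSeminorm (multiplierSeminormFamily A E E p) where
  add_le S T := map_add_le_add _ S T
  smul_eq c T := map_smul_eq_mul _ c T
  mul_le S T := by
    change opSeminorm p.1 (S * T).restrict ≤ _
    rw [restrict_mul]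
    exact (isCStarSeminorm_opSeminorm p.2).mul_le _ _
  star_mul_self T := by
    change opSeminorm p.1 (T.adj * T).restrict = _
    rw [restrict_mul, restrict_adj]
    exact (isCStarSeminorm_opSeminorm p.2).star_mul_self _

variable (A E) in
/-- Restriction to `E` as a `*`-isomorphism. -/
def restrictStarAlgEquiv :
    Adjointable (Multiplier A) (MultiplierModule A E) (MultiplierModule A E) ≃⋆ₐ[ℂ]
      Adjointable A E E where
  toFun := restrict
  invFun := extend
  left_inv := extend_restrict
  right_inv := restrict_extend
  map_mul' := restrict_mul
  map_add' := restrict_add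
  map_star' := restrict_adj
  map_smul' := restrict_smul

end Adjointable

end Restriction

end LocallyCStar

end

theorem theorem4p1 {A : Type*} [NonUnitalRing A] [StarRing A] [Module ℂ A]
    [IsScalarTower ℂ A A] [SMulCommClass ℂ A A] [StarModule ℂ A]
    [TopologicalSpace A] [LocallyCStarAlgebra A]
    {E : Type*} [AddCommGroup E] [Module ℂ E] [InnerModule A E] [HilbertModule A E]
    {F : Type*} [AddCommGroup F] [Module ℂ F] [InnerModule A F] [HilbertModule A F] :
    -- (1) restriction is an isomorphism of complete locally convex spaces
    (CompleteLocallyConvex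
        (Adjointable (Multiplier A) (MultiplierModule A E) (MultiplierModule A F)) ∧
      CompleteLocallyConvex (Adjointable A E F) ∧
      ∃ Φ : Adjointable (Multiplier A) (MultiplierModule A E) (MultiplierModule A F) ≃L[ℂ]
          Adjointable A E F,
        (∀ T, ∀ ξ : E, T (embed ξ) = embed (Φ T ξ)) ∧
        ∀ p ∈ contSeminorms A, ∀ T, (Φ T).opSeminorm p = T.opSeminorm (Multiplier.seminorm p)) ∧
    -- (2) for `F = E` it is an isomorphism of locally C*-algebras
    (LocallyCStarAlgebra
        (Adjointable (Multiplier A) (MultiplierModule A E) (MultiplierModule A E)) ∧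
      LocallyCStarAlgebra (Adjointable A E E) ∧
      ∃ Ψ : Adjointable (Multiplier A) (MultiplierModule A E) (MultiplierModule A E) ≃⋆ₐ[ℂ]
          Adjointable A E E,
        Continuous Ψ ∧ Continuous Ψ.symm ∧
        (∀ T, ∀ ξ : E, T (embed ξ) = embed (Ψ T ξ)) ∧
        ∀ p ∈ contSeminorms A, ∀ T,
          (Ψ T).opSeminorm p = T.opSeminorm (Multiplier.seminorm p)) := by
  refine ⟨⟨completeLocallyConvex_of_withSeminorms
      (Adjointable.withSeminorms_multiplierSeminormFamily A E F)
      (fun _ => Adjointable.eq_zero_of_forall_multiplierSeminormFamily_eq_zero)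
      Adjointable.exists_limit_multiplier,
    Adjointable.completeLocallyConvex A E F, Adjointable.restrictCLE A E F,
    Adjointable.apply_embed, fun p hp T => T.opSeminorm_restrict hp⟩,
    locallyCStarAlgebra_of_withSeminorms
      (Adjointable.withSeminorms_multiplierSeminormFamily A E E)
      Adjointable.isCStarSeminorm_multiplierSeminormFamily
      (fun _ => Adjointable.eq_zero_of_forall_multiplierSeminormFamily_eq_zero)
      Adjointable.exists_limit_multiplier,
    Adjointable.locallyCStarAlgebra A E, Adjointable.restrictStarAlgEquiv A E,
    (Adjointable.restrictCLE A E E).continuous, (Adjointable.restrictCLE A E E).symm.continuous,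
    Adjointable.apply_embed, fun p hp T => T.opSeminorm_restrict hp⟩
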